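/- Let $1\le k\le N$ be integers, $n=\lceil N/k\rceil$ and $\ell=nk-N$, so that $0\le \ell<k$. \emph{Matrices.} $\mathcal J_{k,N}$ is the set of Hermitian block tridiagonal matrices $J\in\mathbb C^{N\times N}$ with diagonal blocks $A_0,\dots,A_{n-1}$, subdiagonal blocks $B_0,\dots,B_{n-2}$ and superdiagonal blocks $B_0^*,\dots,B_{n-2}^*$, where $A_0,\dots,A_{n-2}\in\mathbb C^{k\times k}$ and $A_{n-1}\in\mathbb C^{(k-\ell)\times(k-\ell)}$ are Hermitian, $B_0,\dots,B_{n-3}\in\mathbb C^{k\times k}$ are upper triangular with positive diagonal entries, and $B_{n-2}\in\mathbb C^{(k-\ell)\times k}$ has full rank and is in row echelon form with positive pivots. For $J\in\mathcal J_{k,N}$ with eigenvalues $\lambda_1,\dots,\lambda_N$ and a corresponding orthonormal basis of eigenvectors, let $v_j\in\mathbb C^k$ be the vector of the first $k$ components of the $j$-th eigenvector, and put $$\varphi(J)=\sum_{j=1}^N v_jv_j^*\,\delta_{\lambda_j}.$$ \emph{Measures.} For a $k\times k$ matrix-valued measure $\mu$ on $\mathbb R$ and matrix polynomials $F,G$ with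 $k$ rows, let $\langle F,G\rangle_\mu=\int F(x)^*\mu(dx)G(x)$, and let $\mathcal N_d$ be the space of polynomials $p$ of degree at most $d$ with coefficients in $\mathbb C^k$ such that $\langle p,p\rangle_\mu=0$. Let $\mathcal M_{k,N}$ be the set of measures $\mu=\sum_{j=1}^m W_j\delta_{x_j}$ with distinct $x_j\in\mathbb R$, positive semidefinite $W_j\in\mathbb C^{k\times k}$, $\sum_j W_j=I_k$, $\sum_j\operatorname{rank}W_j=N$, $\dim\mathcal N_d=0$ for $0\le d<n-1$, and $\dim\mathcal N_{n-1}=\ell$. \emph{Recurrence coefficients.} Let $\mu\in\mathcal M_{k,N}$, let $\Pi_0,\dots,\Pi_{n-1}$ be the monic matrix orthogonal polynomials of $\mu$ ($\deg\Pi_j=j$, leading coefficient $I_k$, $\langle\Pi_i,\Pi_j\rangle_\mu=0$ for $i\ne j$), and $\gamma_j=\langle\Pi_j,\Pi_j\rangle_\mu$. Put $P_0=I_k$ and, for $1\le j\le n-2$, $P_j=\Pi_j\gamma_j^{-1/2}Q_j$, where the unitary matrices $Q_j$ are chosen so that $B_j=\langle P_{j+1},xP_j\rangle_\mu$ is upper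 triangular with positive diagonal entries for $0\le j\le n-3$. If $n\ge2$, put $$P=xP_{n-2}-P_{n-2}A_{n-2}-P_{n-3}B_{n-3}^*,\qquad A_{n-2}=\langle P_{n-2},xP_{n-2}\rangle_\mu$$ (with $P_{-1}=0$), let $B_{n-2}\in\mathbb C^{(k-\ell)\times k}$ be in row echelon form with positive pivots such that $\langle P,P\rangle_\mu=B_{n-2}^*B_{n-2}$, and put $P_{n-1}=PB_{n-2}^\dagger$, where $B_{n-2}^\dagger=B_{n-2}^*(B_{n-2}B_{n-2}^*)^{-1}$. Finally let $A_j=\langle P_j,xP_j\rangle_\mu$ for $0\le j\le n-1$. \textbf{Theorem.} For every $\mu\in\mathcal M_{k,N}$ the coefficients $A_0,\dots,A_{n-1}$, $B_0,\dots,B_{n-2}$ exist and are unique, so that the block tridiagonal matrix $\psi(\mu)\in\mathbb C^{N\times N}$ with these diagonal and subdiagonal blocks (and superdiagonal blocks $B_j^*$) is well defined; moreover $\psi(\mu)\in\mathcal J_{k,N}$ and $\varphi(\psi(\mu))=\mu$. Consequently $\varphi$ is a bijection from $\mathcal J_{k,N}$ onto $\mathcal M_{k,N}$, with inverse $\psi$.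 -/

import Mathlib

open MeasureTheory Polynomial Matrix
open scoped ComplexOrder

noncomputable section

namespace BandedSpectral

/-! ### Block structure of `N × N` matrices with blocks of size `k` -/

/-- The number of diagonal blocks, `n = ⌈N / k⌉`. -/
def numBlocks (k N : ℕ) : ℕ := N ⌈/⌉ k

/-- The defect `ℓ = n k - N` of the last block. -/
def defect (k N : ℕ) : ℕ := numBlocks k N * k - N

/-- The size of the `j`-th block (counted from `0`): it is `k` for `j < n - 1`, and
`k - ℓ = N - (n - 1) k` for `j = n - 1`. -/
def blockSize (k N j : ℕ) : ℕ := min k (N - j * k)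

theorem blockSize_le (k N j : ℕ) : blockSize k N j ≤ k := min_le_left _ _

/-- The position in `{0, …, N - 1}` of the `a`-th index of the `j`-th block. -/
def blockIndex (k N j : ℕ) (a : Fin (blockSize k N j)) : Fin N :=
  ⟨j * k + a, by
    have h := a.isLt
    unfold blockSize at h
    have h2 : (a : ℕ) < N - j * k := lt_of_lt_of_le h (min_le_right _ _)
    omega⟩

/-- The block selection matrix: the columns of the `N × N` identity that belong to block `j`. -/
def blockSel (k N j : ℕ) : Matrix (Fin N) (Fin (blockSize k N j)) ℂ :=
  (1 : Matrix (Fin N) (Fin N) ℂ).submatrix id (blockIndex k N j)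

/-- The `N × N` block tridiagonal matrix with diagonal blocks `A 0, …, A (n-1)`, subdiagonal
blocks `B 0, …, B (n-2)` and superdiagonal blocks `(B 0)ᴴ, …, (B (n-2))ᴴ`. Only the entries of the
two families with these indices are used. -/
def blockTridiag (k N : ℕ)
    (A : ∀ j, Matrix (Fin (blockSize k N j)) (Fin (blockSize k N j)) ℂ)
    (B : ∀ j, Matrix (Fin (blockSize k N (j + 1))) (Fin (blockSize k N j)) ℂ) :
    Matrix (Fin N) (Fin N) ℂ :=
  ∑ j ∈ Finset.range (numBlocks k N), blockSel k N j * A j * (blockSel k N j)ᴴ +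
  ∑ j ∈ Finset.range (numBlocks k N - 1),
    (blockSel k N (j + 1) * B j * (blockSel k N j)ᴴ +
      blockSel k N j * (B j)ᴴ * (blockSel k N (j + 1))ᴴ)

/-- Upper triangular with positive diagonal entries. -/
def IsUpperTriangularPos {r s : ℕ} (M : Matrix (Fin r) (Fin s) ℂ) : Prop :=
  (∀ (a : Fin r) (b : Fin s), (b : ℕ) < (a : ℕ) → M a b = 0) ∧
  (∀ (a : Fin r) (b : Fin s), (a : ℕ) = (b : ℕ) → 0 < M a b)

/-- Row echelon form with positive pivots. -/
def IsRowEchelonPos {r s : ℕ} (M : Matrix (Fin r) (Fin s) ℂ) : Prop :=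
  M.IsRowEchelon ∧ ∀ i c, M.IsLeadingEntry i c → 0 < M i c

/-- The class `𝒥_{k,N}` of banded Hermitian matrices. -/
def bandedClass (k N : ℕ) : Set (Matrix (Fin N) (Fin N) ℂ) :=
  {J | ∃ (A : ∀ j, Matrix (Fin (blockSize k N j)) (Fin (blockSize k N j)) ℂ)
      (B : ∀ j, Matrix (Fin (blockSize k N (j + 1))) (Fin (blockSize k N j)) ℂ),
      (∀ j, j < numBlocks k N → (A j).IsHermitian) ∧
      (∀ j, j + 1 < numBlocks k N → (B j).rank = blockSize k N (j + 1)) ∧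
      (∀ j, j + 2 < numBlocks k N → IsUpperTriangularPos (B j)) ∧
      (∀ j, j + 2 = numBlocks k N → IsRowEchelonPos (B j)) ∧
      J = blockTridiag k N A B}

/-! ### Matrix-valued measures and the quasi-inner product -/

/-- `k × k` complex matrix-valued (countably additive) Borel set functions on `ℝ`. -/
abbrev MatMeasure (k : ℕ) : Type := VectorMeasure ℝ (Matrix (Fin k) (Fin k) ℂ)

/-- The complex measure `μ_{ab}` given by the `(a, b)` entry of a matrix-valued measure. -/
def entryMeasure {k : ℕ} (μ : MatMeasure k) (a b : Fin k) : ComplexMeasure ℝ :=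
  μ.mapRange (Matrix.entryAddMonoidHom ℂ a b) (continuous_id.matrix_elem a b)

/-- The right quasi-inner product `⟨F, G⟩_μ = ∫ F(x)ᴴ μ(dx) G(x)` of matrix polynomials,
written entrywise. Matrix polynomials with `r` columns are `k × r` matrices over `ℂ[X]`. -/
def quasiInner {k r s : ℕ} (μ : MatMeasure k)
    (F : Matrix (Fin k) (Fin r) ℂ[X]) (G : Matrix (Fin k) (Fin s) ℂ[X]) :
    Matrix (Fin r) (Fin s) ℂ :=
  Matrix.of fun i j => ∑ a, ∑ b,
    (entryMeasure μ a b).integral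
      (fun x : ℝ => star ((F a i).eval (x : ℂ)) * (G b j).eval (x : ℂ))
      (ContinuousLinearMap.mul ℝ ℂ)

/-- The set `𝒩_d` of vector polynomials `p` of degree at most `d` with `⟨p, p⟩_μ = 0`. -/
def nullPolys {k : ℕ} (μ : MatMeasure k) (d : ℕ) : Set (Fin k → ℂ[X]) :=
  {p | (∀ a, (p a).natDegree ≤ d) ∧
    quasiInner μ (Matrix.replicateCol (Fin 1) p) (Matrix.replicateCol (Fin 1) p) = 0}

/-- The set `ℳ_{k,N}`: measures `∑_{x ∈ s} W x δ_x` over a finite set `s` of reals with positive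
semidefinite weights, total mass `I`, total rank `N`, and `dim 𝒩_d = 0` for `d < n - 1`,
`dim 𝒩_{n-1} = ℓ`. For a positive semidefinite measure `𝒩_d` is a linear subspace, so that
`Set.finrank`, the dimension of the linear span, is its dimension. -/
def measureClass (k N : ℕ) : Set (MatMeasure k) :=
  {μ | (∃ (s : Finset ℝ) (W : ℝ → Matrix (Fin k) (Fin k) ℂ),
      μ = ∑ x ∈ s, VectorMeasure.dirac x (W x) ∧
      (∀ x ∈ s, (W x).PosSemidef) ∧
      ∑ x ∈ s, W x = 1 ∧
      ∑ x ∈ s, (W x).rank = N) ∧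
    (∀ d, d + 1 < numBlocks k N → Set.finrank ℂ (nullPolys μ d) = 0) ∧
    (∀ d, d + 1 = numBlocks k N → Set.finrank ℂ (nullPolys μ d) = defect k N)}

/-! ### The spectral map `φ` -/

/-- The first `k` components of the `j`-th normalized eigenvector of a Hermitian matrix. -/
def eigenvectorHead {k N : ℕ} (hkN : k ≤ N) {J : Matrix (Fin N) (Fin N) ℂ}
    (hJ : J.IsHermitian) (j : Fin N) : Fin k → ℂ :=
  fun a => hJ.eigenvectorBasis j (Fin.castLE hkN a)

open Classical in
/-- The spectral map `φ(J) = ∑_j v_j v_jᴴ δ_{λ_j}`, for Hermitian `J` (all elements of `𝒥_{k,N}`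
are Hermitian; the value `0` for other matrices is never used). -/
def spectralMap {k N : ℕ} (hkN : k ≤ N) (J : Matrix (Fin N) (Fin N) ℂ) : MatMeasure k :=
  if hJ : J.IsHermitian then
    ∑ j, VectorMeasure.dirac (hJ.eigenvalues j)
      (Matrix.vecMulVec (eigenvectorHead hkN hJ j) (star (eigenvectorHead hkN hJ j)))
  else 0

/-! ### Orthogonal polynomials and the inverse spectral map `ψ` -/

/-- `Π 0, …, Π (n-1)` are monic `k × k` matrix polynomials, `Π j` of degree `j`, orthogonal with
respect to `μ`. -/
def IsMonicOrthogonal {k : ℕ} (μ : MatMeasure k) (n : ℕ)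
    (Pi : ℕ → Matrix (Fin k) (Fin k) ℂ[X]) : Prop :=
  (∀ j < n, (∀ a b, (Pi j a b).natDegree ≤ j) ∧ (Pi j).map (fun p => p.coeff j) = 1) ∧
  (∀ i < n, ∀ j < n, i ≠ j → quasiInner μ (Pi i) (Pi j) = 0)

/-- The right inverse `Bᴴ (B Bᴴ)⁻¹` (the Moore-Penrose pseudoinverse) of a matrix of full row
rank. -/
def rightInv {r s : ℕ} (B : Matrix (Fin r) (Fin s) ℂ) : Matrix (Fin s) (Fin r) ℂ :=
  Bᴴ * (B * Bᴴ)⁻¹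

/-- The polynomial `x P_j(x) - P_j(x) A_j - P_{j-1}(x) (B_{j-1})ᴴ`, with `P_{-1} = 0`. -/
def residual {k N : ℕ} (P : ∀ j, Matrix (Fin k) (Fin (blockSize k N j)) ℂ[X])
    (A : ∀ j, Matrix (Fin (blockSize k N j)) (Fin (blockSize k N j)) ℂ)
    (B : ∀ j, Matrix (Fin (blockSize k N (j + 1))) (Fin (blockSize k N j)) ℂ) :
    ∀ j, Matrix (Fin k) (Fin (blockSize k N j)) ℂ[X]
  | 0 => (X : ℂ[X]) • P 0 - P 0 * (A 0).map C
  | j + 1 => (X : ℂ[X]) • P (j + 1) - P (j + 1) * (A (j + 1)).map C - P j * (B j)ᴴ.map C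

/-- `P 0, …, P (n-1)` are the normalized orthonormal polynomials of `μ`, with recurrence
coefficients `A 0, …, A (n-1)` and `B 0, …, B (n-2)`. The blocks with index below `n - 1` have `k`
columns, and restricting columns along `Fin.castLE` is only a change of the index type there (and
for block `0` if `k ≤ N`). -/
structure IsNormalizedOPS (k N : ℕ) (μ : MatMeasure k)
    (P : ∀ j, Matrix (Fin k) (Fin (blockSize k N j)) ℂ[X])
    (A : ∀ j, Matrix (Fin (blockSize k N j)) (Fin (blockSize k N j)) ℂ)
    (B : ∀ j, Matrix (Fin (blockSize k N (j + 1))) (Fin (blockSize k N j)) ℂ) : Prop where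
  /-- `P_0 = I`. -/
  zero : P 0 = (1 : Matrix (Fin k) (Fin k) ℂ[X]).submatrix id (Fin.castLE (blockSize_le k N 0))
  /-- `P_j = Π_j γ_j^{-1/2} Q_j` with `Q_j` unitary, for `j ≤ n - 2`, where `Π_j` is the monic
  orthogonal polynomial and `γ_j = ⟨Π_j, Π_j⟩_μ`; `R` below is the positive definite square root
  of `γ_j`. -/
  normalization : ∃ Pi : ℕ → Matrix (Fin k) (Fin k) ℂ[X],
    IsMonicOrthogonal μ (numBlocks k N) Pi ∧
    ∀ j, j + 1 < numBlocks k N → ∃ R Q : Matrix (Fin k) (Fin k) ℂ,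
      R.PosDef ∧ R * R = quasiInner μ (Pi j) (Pi j) ∧ Q ∈ Matrix.unitaryGroup (Fin k) ℂ ∧
      P j = (Pi j * (R⁻¹ * Q).map C).submatrix id (Fin.castLE (blockSize_le k N j))
  /-- `A_j = ⟨P_j, x P_j⟩_μ` for `j ≤ n - 1`. -/
  diag : ∀ j, j < numBlocks k N → A j = quasiInner μ (P j) ((X : ℂ[X]) • P j)
  /-- `B_j = ⟨P_{j+1}, x P_j⟩_μ` for `j ≤ n - 3`. -/
  subdiag : ∀ j, j + 2 < numBlocks k N → B j = quasiInner μ (P (j + 1)) ((X : ℂ[X]) • P j)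
  /-- `B_j` is upper triangular with positive diagonal entries for `j ≤ n - 3`. -/
  subdiag_pos : ∀ j, j + 2 < numBlocks k N → IsUpperTriangularPos (B j)
  /-- `B_{n-2}` is in row echelon form with positive pivots. -/
  last_echelon : ∀ j, j + 2 = numBlocks k N → IsRowEchelonPos (B j)
  /-- `(B_{n-2})ᴴ B_{n-2} = ⟨P, P⟩_μ`, with `P` the polynomial `residual` of index `n - 2`. -/
  last_norm : ∀ j, j + 2 = numBlocks k N →
    quasiInner μ (residual P A B j) (residual P A B j) = (B j)ᴴ * B j
  /-- `P_{n-1} = P (B_{n-2})†`. -/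
  last_poly : ∀ j, j + 2 = numBlocks k N → P (j + 1) = residual P A B j * (rightInv (B j)).map C

/-- `J` is the block tridiagonal matrix of the recurrence coefficients of the normalized
orthonormal polynomials of `μ`. -/
def IsRecurrenceMatrix (k N : ℕ) (μ : MatMeasure k) (J : Matrix (Fin N) (Fin N) ℂ) : Prop :=
  ∃ P A B, IsNormalizedOPS k N μ P A B ∧ J = blockTridiag k N A B

/-- The inverse spectral map `ψ`: it sends `μ` to the matrix of its recurrence coefficients. -/
def inverseSpectralMap (k N : ℕ) (μ : MatMeasure k) : Matrix (Fin N) (Fin N) ℂ :=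
  Classical.epsilon (IsRecurrenceMatrix k N μ)

end BandedSpectral

end

/-!
A pair `(T, E)` with `⟨F, G⟩_μ = F(T, E)ᴴ G(T, E)`, where `F(T, E) = ∑ᵢ Tⁱ E Fᵢ`, is a model of `μ`:
the rank-one atoms of `μ` give a model with `T` diagonal, and a Hermitian `J` with the first `k`
columns of the identity is a model of `φ(J)`. In a model, `dim 𝒩_d` is the nullity of the Krylov
matrix `[E, TE, …, T^d E]`. For block tridiagonal `J` the three-term recurrence produces polynomials
whose values at `J` are the block columns of the identity; hence they are orthonormal, and the
Krylov matrix has the ranks required by the definition of `ℳ_{k,N}`.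

Surjectivity is block Lanczos: Gram–Schmidt on the columns of the Krylov matrix of any model of `μ`
conjugates it by a unitary to a model whose Krylov matrix is in row echelon form with positive
pivots, and this forces the banded shape with its normalized blocks. Uniqueness of the coefficients
holds because a row echelon matrix `B` with positive pivots is determined by `BᴴB`.
-/

noncomputable section

namespace BandedSpectral

/-! ### Echelon matrices -/

section Rank

variable {m n K : Type*} [Field K] {M : Matrix m n K}

theorem linearIndependent_row_iff_rank_eq [Fintype m] [Fintype n] :
    LinearIndependent K M.row ↔ M.rank = Fintype.card m := by
  rw [linearIndependent_iff_card_eq_finrank_span, rank_eq_finrank_span_row, eq_comm]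
  rfl

theorem mulVec_injective_iff_rank_eq [Fintype n] :
    Function.Injective M.mulVec ↔ M.rank = Fintype.card n := by
  rw [Matrix.mulVec_injective_iff, linearIndependent_iff_card_eq_finrank_span,
    rank_eq_finrank_span_cols, eq_comm]
  rfl

end Rank

theorem mul_rightInv {r s : ℕ} {B : Matrix (Fin r) (Fin s) ℂ} (hB : B.rank = r) :
    B * rightInv B = 1 := by
  have hunit : IsUnit (B * Bᴴ) := by
    rw [← linearIndependent_rows_iff_isUnit, linearIndependent_row_iff_rank_eq,
      rank_self_mul_conjTranspose, hB, Fintype.card_fin]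
  rw [rightInv, ← Matrix.mul_assoc, mul_nonsing_inv _ ((isUnit_iff_isUnit_det _).1 hunit)]

theorem eq_of_sum_eq_sum_of_forall_ne {ι M : Type*} [Fintype ι] [AddCancelCommMonoid M]
    {f g : ι → M} (i : ι) (hsum : ∑ x, f x = ∑ x, g x) (hne : ∀ x, x ≠ i → f x = g x) :
    f i = g i := by
  classical
  rw [← Finset.add_sum_erase _ _ (Finset.mem_univ i),
    ← Finset.add_sum_erase (a := i) _ _ (Finset.mem_univ i),
    Finset.sum_congr rfl fun x hx => hne x (Finset.ne_of_mem_erase hx)] at hsum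
  exact add_right_cancel hsum

theorem eq_of_star_mul_self_eq_of_nonneg {R : Type*} [CommRing R] [NoZeroDivisors R] [StarRing R]
    [PartialOrder R] [StarOrderedRing R] {a b : R} (ha : 0 ≤ a) (hb : 0 ≤ b)
    (h : star a * a = star b * b) : a = b := by
  rw [(IsSelfAdjoint.of_nonneg ha).star_eq, (IsSelfAdjoint.of_nonneg hb).star_eq,
    mul_self_eq_mul_self_iff] at h
  rcases h with h | h
  · exact h
  · have ha0 : a = 0 := le_antisymm (h ▸ neg_nonpos.2 hb) ha
    rw [ha0, eq_comm, neg_eq_zero] at h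
    rw [ha0, h]

namespace IsRowEchelonPos

variable {r s : ℕ} {B B' : Matrix (Fin r) (Fin s) ℂ} {i : Fin r} {c : Fin s}

theorem nonneg_of_forall_lt_eq_zero (hB : IsRowEchelonPos B) (hzero : ∀ d < c, B i d = 0) :
    0 ≤ B i c := by
  by_cases h : B i c = 0
  · exact h.ge
  · exact (hB.2 i c ⟨hzero, h⟩).le

theorem apply_eq_of_forall_lt_eq_zero (hB : IsRowEchelonPos B) (hB' : IsRowEchelonPos B')
    (hgram : Bᴴ * B = B'ᴴ * B') (hzero : ∀ d < c, B i d = 0) (hzero' : ∀ d < c, B' i d = 0)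
    (habove : ∀ x < i, B x c = B' x c) : B i c = B' i c := by
  refine eq_of_star_mul_self_eq_of_nonneg (hB.nonneg_of_forall_lt_eq_zero hzero)
    (hB'.nonneg_of_forall_lt_eq_zero hzero') ?_
  refine eq_of_sum_eq_sum_of_forall_ne (f := fun x => star (B x c) * B x c)
    (g := fun x => star (B' x c) * B' x c) i (congrFun₂ hgram c c) fun x hx => ?_
  rcases lt_or_gt_of_ne hx with hlt | hgt
  · rw [habove x hlt]
  · rw [hB.1 hgt hzero, hB'.1 hgt hzero']

theorem apply_eq_of_isLeadingEntry {d : Fin s} (hB : IsRowEchelonPos B)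
    (hgram : Bᴴ * B = B'ᴴ * B') (hlead : B.IsLeadingEntry i d) (hcol : ∀ x, B x d = B' x d)
    (habove : ∀ x < i, B x c = B' x c) : B i c = B' i c := by
  have hentry := congrFun₂ hgram d c
  simp only [Matrix.mul_apply, conjTranspose_apply, ← hcol] at hentry
  refine mul_left_cancel₀ (star_ne_zero.2 hlead.2)
    (eq_of_sum_eq_sum_of_forall_ne (f := fun x => star (B x d) * B x c)
      (g := fun x => star (B x d) * B' x c) i hentry fun x hx => ?_)
  rcases lt_or_gt_of_ne hx with hlt | hgt
  · rw [habove x hlt]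
  · rw [hB.1 hgt hlead.1, star_zero, zero_mul, zero_mul]

theorem eq_of_gram_eq (hB : IsRowEchelonPos B) (hB' : IsRowEchelonPos B')
    (hgram : Bᴴ * B = B'ᴴ * B') : B = B' := by
  suffices hcol : ∀ c i, B i c = B' i c from Matrix.ext fun i c => hcol c i
  intro c
  induction c using WellFoundedLT.induction with
  | ind c hleft =>
  intro i
  induction i using WellFoundedLT.induction with
  | ind i habove =>
  by_cases hzero : ∀ d < c, B i d = 0
  · exact hB.apply_eq_of_forall_lt_eq_zero hB' hgram hzero
      (fun d hd => by rw [← hleft d hd i, hzero d hd]) habove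
  · push Not at hzero
    obtain ⟨e, hec, he⟩ := hzero
    obtain ⟨d, hlead⟩ := row_ne_zero_iff_exists_isLeadingEntry.1
      (fun h : B i = 0 => he (congrFun h e))
    have hde : d ≤ e := not_lt.1 fun h => he (hlead.1 e h)
    exact hB.apply_eq_of_isLeadingEntry hgram hlead (hleft d (hde.trans_lt hec)) habove

end IsRowEchelonPos

/-- `p i` is the position of the leading entry of the `i`-th row of `M`. The rows are nonzero, the
leading entries are positive, and their positions increase strictly, so `M` is a row echelon matrix
of full rank; recording `p` makes it possible to compute with these positions. -/
structure HasPivots {m n R : Type*} [Preorder m] [Preorder n] [Zero R] [LT R]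
    (M : Matrix m n R) (p : m → n) : Prop where
  strictMono : StrictMono p
  zero : ∀ i c, c < p i → M i c = 0
  pos : ∀ i, 0 < M i (p i)

namespace HasPivots

section General

variable {m n R : Type*} [LinearOrder m] [LinearOrder n] [CommRing R] [PartialOrder R]
  {M : Matrix m n R} {p : m → n}

theorem isPivotedBy (h : HasPivots M p) : M.IsPivotedBy fun i => (p i : WithTop n) := by
  refine isPivotedBy_iff.2 ⟨fun i j hij => WithTop.coe_le_coe.2 (h.strictMono.monotone hij),
    fun i _ j _ hij => WithTop.coe_lt_coe.2 (h.strictMono hij), fun i => ⟨fun j hj => ?_, ?_⟩⟩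
  · exact h.zero i j (WithTop.coe_lt_coe.1 hj)
  · rintro c hc
    rw [← WithTop.coe_inj.1 hc]
    exact (h.pos i).ne'

theorem rank_eq [Fintype m] [Fintype n] [IsDomain R] (h : HasPivots M p) :
    M.rank = Fintype.card m := by
  rw [h.isPivotedBy.rank_eq]
  simp

end General

variable {r s : ℕ} {M : Matrix (Fin r) (Fin s) ℂ} {p : Fin r → Fin s}

theorem isRowEchelonPos (h : HasPivots M p) : IsRowEchelonPos M :=
  ⟨h.isPivotedBy.isRowEchelon, fun i c hc => by
    rw [hc.unique (h.isPivotedBy.isLeadingEntry rfl)]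
    exact h.pos i⟩

end HasPivots

theorem IsUpperTriangularPos.hasPivots {r s : ℕ} {M : Matrix (Fin r) (Fin s) ℂ} (hrs : r ≤ s)
    (h : IsUpperTriangularPos M) : HasPivots M (Fin.castLE hrs) :=
  ⟨Fin.strictMono_castLE hrs, fun i c hc => h.1 i c hc, fun i => h.2 i _ rfl⟩

/-! ### Evaluation of matrix polynomials at a matrix -/

section Eval

variable {R ι κ : Type*} [CommRing R] [Fintype ι] [DecidableEq ι] [Fintype κ]

/-- The value `∑ₐ pₐ(T) E eₐ` of the vector polynomial `p` at the matrix `T`, with starting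
vectors the columns `E eₐ` of `E`. -/
def vecEval (T : Matrix ι ι R) (E : Matrix ι κ R) : (κ → R[X]) →ₗ[R] (ι → R) where
  toFun p := ∑ a, aeval T (p a) *ᵥ E.col a
  map_add' p q := by simp [Matrix.add_mulVec, Finset.sum_add_distrib]
  map_smul' c p := by simp [Matrix.smul_mulVec, Finset.smul_sum]

/-- The value `∑ᵢ Tⁱ E Fᵢ` of the matrix polynomial `F = ∑ᵢ Fᵢ Xⁱ` at the matrix `T`, with starting
vectors the columns of `E`; it is computed column by column. -/
def polyEval {ρ : Type*} (T : Matrix ι ι R) (E : Matrix ι κ R) :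
    Matrix κ ρ R[X] →ₗ[R] Matrix ι ρ R where
  toFun F := Matrix.of fun i j => vecEval T E (F.col j) i
  map_add' F G := by
    ext i j
    exact congrFun ((vecEval T E).map_add (F.col j) (G.col j)) i
  map_smul' c F := by
    ext i j
    exact congrFun ((vecEval T E).map_smul c (F.col j)) i

variable {ρ σ : Type*} (T : Matrix ι ι R) (E : Matrix ι κ R)

theorem vecEval_apply (p : κ → R[X]) : vecEval T E p = ∑ a, aeval T (p a) *ᵥ E.col a := rfl

theorem polyEval_apply (F : Matrix κ ρ R[X]) (i : ι) (j : ρ) :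
    polyEval T E F i j = vecEval T E (F.col j) i := rfl

theorem polyEval_submatrix (F : Matrix κ ρ R[X]) (f : σ → ρ) :
    polyEval T E (F.submatrix id f) = (polyEval T E F).submatrix id f := rfl

theorem polyEval_X_smul (F : Matrix κ ρ R[X]) :
    polyEval T E ((X : R[X]) • F) = T * polyEval T E F := by
  ext i j
  suffices vecEval T E (((X : R[X]) • F).col j) = T *ᵥ vecEval T E (F.col j) from congrFun this i
  simp [vecEval_apply, Matrix.mulVec_sum, Matrix.mulVec_mulVec]

theorem polyEval_mul_map_C [Fintype ρ] (F : Matrix κ ρ R[X]) (M : Matrix ρ σ R) :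
    polyEval T E (F * M.map C) = polyEval T E F * M := by
  ext i j
  have hcol : (F * M.map C).col j = ∑ b, M b j • F.col b := by
    funext a
    simp [Matrix.mul_apply, Polynomial.smul_eq_C_mul, mul_comm]
  simp only [polyEval_apply, hcol, map_sum, map_smul, Finset.sum_apply, Pi.smul_apply, smul_eq_mul,
    Matrix.mul_apply, mul_comm]

theorem polyEval_one [DecidableEq κ] : polyEval T E (1 : Matrix κ κ R[X]) = E := by
  ext i j
  rw [polyEval_apply, vecEval_apply, Finset.sum_eq_single j]
  · simp
  · intro b _ hb
    simp [Matrix.one_apply_ne hb]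
  · simp

section Intertwining

variable {ι' : Type*} [Fintype ι'] [DecidableEq ι'] {T} {T' : Matrix ι' ι' R} {S : Matrix ι' ι R}

theorem pow_mul_eq_mul_pow_of_mul_eq_mul (h : T' * S = S * T) (n : ℕ) :
    T' ^ n * S = S * T ^ n := by
  induction n with
  | zero => simp
  | succ n ih => rw [pow_succ, Matrix.mul_assoc, h, ← Matrix.mul_assoc, ih, Matrix.mul_assoc,
      ← pow_succ]

theorem aeval_mul_eq_mul_aeval_of_mul_eq_mul (h : T' * S = S * T) (p : R[X]) :
    aeval T' p * S = S * aeval T p := by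
  simp only [aeval_eq_sum_range, Matrix.sum_mul, Matrix.mul_sum, Matrix.smul_mul, Matrix.mul_smul,
    pow_mul_eq_mul_pow_of_mul_eq_mul h]

theorem polyEval_mul_of_mul_eq_mul (h : T' * S = S * T) (F : Matrix κ ρ R[X]) :
    polyEval T' (S * E) F = S * polyEval T E F := by
  ext i j
  suffices vecEval T' (S * E) (F.col j) = S *ᵥ vecEval T E (F.col j) from congrFun this i
  have hcol : ∀ a, (S * E).col a = S *ᵥ E.col a := fun _ => rfl
  simp only [vecEval_apply, hcol, Matrix.mulVec_mulVec, Matrix.mulVec_sum,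
    aeval_mul_eq_mul_aeval_of_mul_eq_mul h]

end Intertwining

end Eval

/-- The pair `(T, E)` represents the quasi-inner product of `μ`: it is the Gram form of the values
of matrix polynomials at `(T, E)`. -/
def IsModel {ι : Type*} [Fintype ι] [DecidableEq ι] {k : ℕ} (T : Matrix ι ι ℂ)
    (E : Matrix ι (Fin k) ℂ) (μ : MatMeasure k) : Prop :=
  ∀ ⦃r s : ℕ⦄ (F : Matrix (Fin k) (Fin r) ℂ[X]) (G : Matrix (Fin k) (Fin s) ℂ[X]),
    quasiInner μ F G = (polyEval T E F)ᴴ * polyEval T E G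

namespace IsModel

variable {ι : Type*} [Fintype ι] [DecidableEq ι] {k : ℕ} {T : Matrix ι ι ℂ}
  {E : Matrix ι (Fin k) ℂ} {μ : MatMeasure k}

theorem mul_of_mul_eq_mul {ι' : Type*} [Fintype ι'] [DecidableEq ι'] (h : IsModel T E μ)
    {T' : Matrix ι' ι' ℂ} {S : Matrix ι' ι ℂ} (hT : T' * S = S * T) (hS : Sᴴ * S = 1) :
    IsModel T' (S * E) μ := by
  intro r s F G
  rw [polyEval_mul_of_mul_eq_mul E hT, polyEval_mul_of_mul_eq_mul E hT,
    Matrix.conjTranspose_mul, Matrix.mul_assoc, ← Matrix.mul_assoc Sᴴ, hS, Matrix.one_mul, h]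

end IsModel

/-! ### Finitely supported measures -/

section SumDirac

variable {ι α M : Type*} [MeasurableSpace α] [AddCommMonoid M] [TopologicalSpace M]
  [ContinuousAdd M]

open Classical in
theorem sum_dirac_apply (s : Finset ι) (x : ι → α) (w : ι → M) {t : Set α}
    (ht : MeasurableSet t) :
    (∑ l ∈ s, VectorMeasure.dirac (x l) (w l)) t = ∑ l ∈ s, if x l ∈ t then w l else 0 := by
  rw [FunLike.coe_sum, Finset.sum_apply]
  refine Finset.sum_congr rfl fun l _ => ?_
  by_cases hx : x l ∈ t <;> simp [hx, ht]

theorem dirac_sum (s : Finset ι) (x : α) (w : ι → M) :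
    VectorMeasure.dirac x (∑ l ∈ s, w l) = ∑ l ∈ s, VectorMeasure.dirac x (w l) := by
  ext1 t ht
  rw [sum_dirac_apply s (fun _ => x) w ht]
  by_cases hx : x ∈ t <;> simp [hx, ht]

end SumDirac

section QuasiInner

variable {ι : Type*} {k : ℕ}

theorem entryMeasure_sum_dirac (S : Finset ι) (x : ι → ℝ) (W : ι → Matrix (Fin k) (Fin k) ℂ)
    (a b : Fin k) :
    entryMeasure (∑ l ∈ S, VectorMeasure.dirac (x l) (W l)) a b =
      ∑ l ∈ S, VectorMeasure.dirac (x l) (W l a b) := by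
  ext t ht
  change (∑ l ∈ S, VectorMeasure.dirac (x l) (W l)) t a b = _
  rw [sum_dirac_apply _ _ _ ht, sum_dirac_apply _ _ _ ht, Matrix.sum_apply]
  refine Finset.sum_congr rfl fun l _ => ?_
  by_cases hx : x l ∈ t <;> simp [hx]

theorem quasiInner_sum_dirac (S : Finset ι) (x : ι → ℝ) (W : ι → Matrix (Fin k) (Fin k) ℂ)
    {r s : ℕ} (F : Matrix (Fin k) (Fin r) ℂ[X]) (G : Matrix (Fin k) (Fin s) ℂ[X]) :
    quasiInner (∑ l ∈ S, VectorMeasure.dirac (x l) (W l)) F G =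
      ∑ l ∈ S, (F.map (eval (x l : ℂ)))ᴴ * W l * G.map (eval (x l : ℂ)) := by
  have hintegral : ∀ (a b : Fin k) (f : ℝ → ℂ),
      (entryMeasure (∑ l ∈ S, VectorMeasure.dirac (x l) (W l)) a b).integral f
        (ContinuousLinearMap.mul ℝ ℂ) = ∑ l ∈ S, f (x l) * W l a b := by
    intro a b f
    rw [entryMeasure_sum_dirac, VectorMeasure.integral_finsetSum_vectorMeasure]
    · simp
    · intro l _
      rw [VectorMeasure.Integrable, VectorMeasure.variation_dirac]
      exact (integrable_dirac (by simp)).smul_measure (by simp)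
  ext i j
  simp only [quasiInner, Matrix.of_apply, hintegral, Matrix.sum_apply, Matrix.mul_apply,
    conjTranspose_apply, Matrix.map_apply, Finset.sum_mul]
  simp_rw [Finset.sum_comm (s := Finset.univ) (t := S)]
  refine Finset.sum_congr rfl fun l _ => ?_
  rw [Finset.sum_comm]
  exact Finset.sum_congr rfl fun b _ => Finset.sum_congr rfl fun a _ => by ring

theorem quasiInner_sum_dirac_one_smul_one (S : Finset ι) (x : ι → ℝ)
    (W : ι → Matrix (Fin k) (Fin k) ℂ) (f : ℂ[X]) :
    quasiInner (∑ l ∈ S, VectorMeasure.dirac (x l) (W l)) (1 : Matrix (Fin k) (Fin k) ℂ[X])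
      (f • (1 : Matrix (Fin k) (Fin k) ℂ[X])) = ∑ l ∈ S, f.eval (x l : ℂ) • W l := by
  have hone : ∀ y : ℂ, (1 : Matrix (Fin k) (Fin k) ℂ[X]).map (eval y) = 1 := fun y =>
    Matrix.map_one _ eval_zero eval_one
  have hsmul : ∀ y : ℂ, (f • (1 : Matrix (Fin k) (Fin k) ℂ[X])).map (eval y) =
      f.eval y • (1 : Matrix (Fin k) (Fin k) ℂ) := fun y => by
    ext i j
    by_cases hij : i = j <;> simp [hij]
  simp only [quasiInner_sum_dirac, hone, hsmul, conjTranspose_one, Matrix.one_mul,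
    Matrix.mul_smul, Matrix.mul_one]

theorem sum_dirac_ext {κ : Type*} (S : Finset ι) (x : ι → ℝ) (W : ι → Matrix (Fin k) (Fin k) ℂ)
    (S' : Finset κ) (x' : κ → ℝ) (W' : κ → Matrix (Fin k) (Fin k) ℂ)
    (h : ∀ F G : Matrix (Fin k) (Fin k) ℂ[X],
      quasiInner (∑ l ∈ S, VectorMeasure.dirac (x l) (W l)) F G =
        quasiInner (∑ l ∈ S', VectorMeasure.dirac (x' l) (W' l)) F G) :
    ∑ l ∈ S, VectorMeasure.dirac (x l) (W l) = ∑ l ∈ S', VectorMeasure.dirac (x' l) (W' l) := by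
  classical
  ext1 t ht
  rw [sum_dirac_apply _ _ _ ht, sum_dirac_apply _ _ _ ht]
  -- interpolate the indicator function of `t` on the two supports
  obtain ⟨f, hf⟩ : ∃ f : ℂ[X], ∀ y ∈ S.image x ∪ S'.image x',
      f.eval (y : ℂ) = if y ∈ t then 1 else 0 :=
    ⟨Lagrange.interpolate _ (fun y : ℝ => (y : ℂ)) fun y => if y ∈ t then 1 else 0, fun y hy =>
      Lagrange.eval_interpolate_at_node _ Complex.ofReal_injective.injOn hy⟩
  calc ∑ l ∈ S, (if x l ∈ t then W l else 0)
      = ∑ l ∈ S, f.eval (x l : ℂ) • W l := Finset.sum_congr rfl fun l hl => by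
        rw [hf _ (Finset.mem_union_left _ (Finset.mem_image_of_mem x hl)), ite_smul, one_smul,
          zero_smul]
    _ = ∑ l ∈ S', f.eval (x' l : ℂ) • W' l := by
        rw [← quasiInner_sum_dirac_one_smul_one, h, quasiInner_sum_dirac_one_smul_one]
    _ = ∑ l ∈ S', (if x' l ∈ t then W' l else 0) := Finset.sum_congr rfl fun l hl => by
        rw [hf _ (Finset.mem_union_right _ (Finset.mem_image_of_mem x' hl)), ite_smul, one_smul,
          zero_smul]

end QuasiInner

/-- The measure `∑ₗ vₗ vₗᴴ δ_{λₗ}` with rank one weights, in which the points `λₗ` may repeat. -/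
def rankOneSum {ι : Type*} [Fintype ι] {k : ℕ} (lam : ι → ℝ) (v : ι → Fin k → ℂ) : MatMeasure k :=
  ∑ l, VectorMeasure.dirac (lam l) (vecMulVec (v l) (star (v l)))

section Model

variable {ι κ ρ R : Type*} [Fintype ι] [DecidableEq ι] [Fintype κ] [CommRing R]

theorem aeval_diagonal (d : ι → R) (p : R[X]) :
    aeval (diagonal d) p = diagonal fun l => p.eval (d l) := by
  rw [show diagonal d = diagonalAlgHom R d from rfl, aeval_algHom_apply, diagonalAlgHom_apply]
  congr 1
  funext l
  simp

theorem polyEval_diagonal (d : ι → R) (E : Matrix ι κ R) (F : Matrix κ ρ R[X]) (l : ι) (j : ρ) :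
    polyEval (diagonal d) E F l j = (E.row l ᵥ* F.map (eval (d l))) j := by
  rw [polyEval_apply, vecEval_apply, Finset.sum_apply]
  refine Finset.sum_congr rfl fun a _ => ?_
  rw [aeval_diagonal, mulVec_diagonal, mul_comm]
  rfl

variable {k : ℕ}

theorem isModel_rankOneSum (lam : ι → ℝ) (v : ι → Fin k → ℂ) :
    IsModel (diagonal fun l => (lam l : ℂ)) (Matrix.of fun l => star (v l))
      (rankOneSum lam v) := by
  intro r s F G
  rw [rankOneSum, quasiInner_sum_dirac]
  ext i j
  rw [Matrix.sum_apply, Matrix.mul_apply]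
  refine Finset.sum_congr rfl fun l _ => ?_
  rw [conjTranspose_apply, polyEval_diagonal, polyEval_diagonal, mul_vecMulVec, vecMulVec_mul,
    vecMulVec_apply]
  simp [mulVec, vecMul, dotProduct, Matrix.row, mul_comm]

theorem rankOneSum_eq_of_isModel {ι' : Type*} [Fintype ι'] {lam : ι → ℝ} {lam' : ι' → ℝ}
    {v : ι → Fin k → ℂ} {v' : ι' → Fin k → ℂ} {T : Matrix ι ι ℂ} {E : Matrix ι (Fin k) ℂ}
    (h : IsModel T E (rankOneSum lam v)) (h' : IsModel T E (rankOneSum lam' v')) :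
    rankOneSum lam v = rankOneSum lam' v' :=
  sum_dirac_ext _ _ _ _ _ _ fun F G => (h F G).trans (h' F G).symm

end Model

section RankOneDecomposition

variable {n 𝕜 : Type*} [Fintype n] [RCLike 𝕜] {M : Matrix n n 𝕜}

theorem eq_sum_eigenvalues_smul_vecMulVec [DecidableEq n] (hM : M.IsHermitian) :
    M = ∑ i, (hM.eigenvalues i : 𝕜) •
      vecMulVec (hM.eigenvectorBasis i : n → 𝕜) (star (hM.eigenvectorBasis i : n → 𝕜)) := by
  conv_lhs => rw [hM.spectral_theorem, Unitary.conjStarAlgAut_apply]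
  ext a b
  rw [Matrix.mul_apply, Matrix.sum_apply]
  refine Finset.sum_congr rfl fun i _ => ?_
  rw [mul_diagonal, Matrix.smul_apply, vecMulVec_apply, smul_eq_mul, mul_right_comm, mul_comm]
  rfl

theorem exists_eq_sum_vecMulVec_of_posSemidef (hM : M.PosSemidef) :
    ∃ v : Fin M.rank → n → 𝕜, M = ∑ i, vecMulVec (v i) (star (v i)) := by
  classical
  have hcard : M.rank = Fintype.card {i // hM.1.eigenvalues i ≠ 0} :=
    hM.1.rank_eq_card_non_zero_eigs
  let e : Fin M.rank ≃ {i // hM.1.eigenvalues i ≠ 0} :=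
    (finCongr hcard).trans (Fintype.equivFin _).symm
  let w : n → n → 𝕜 := fun i => (√(hM.1.eigenvalues i) : 𝕜) • ⇑(hM.1.eigenvectorBasis i)
  have hw : ∀ i, vecMulVec (w i) (star (w i)) = (hM.1.eigenvalues i : 𝕜) •
      vecMulVec (hM.1.eigenvectorBasis i : n → 𝕜) (star (hM.1.eigenvectorBasis i : n → 𝕜)) := by
    intro i
    have hsqrt : (√(hM.1.eigenvalues i) : 𝕜) * star (√(hM.1.eigenvalues i) : 𝕜) =
        hM.1.eigenvalues i := by
      simp [← RCLike.ofReal_mul, Real.mul_self_sqrt (hM.eigenvalues_nonneg i)]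
    rw [star_smul, smul_vecMulVec, vecMulVec_smul, smul_smul, hsqrt]
  refine ⟨fun l => w (e l), ?_⟩
  rw [e.sum_comp fun i => vecMulVec (w i) (star (w i)),
    ← Finset.sum_subtype (Finset.univ.filter fun i => hM.1.eigenvalues i ≠ 0) (by simp)
      fun i => vecMulVec (w i) (star (w i)),
    Finset.sum_filter_of_ne (p := fun i => hM.1.eigenvalues i ≠ 0)
      fun i _ hi h0 => hi (by simp [hw, h0])]
  simp only [hw]
  exact eq_sum_eigenvalues_smul_vecMulVec hM.1

theorem exists_eq_rankOneSum {k N : ℕ} (s : Finset ℝ) (W : ℝ → Matrix (Fin k) (Fin k) ℂ)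
    (hW : ∀ x ∈ s, (W x).PosSemidef) (hN : ∑ x ∈ s, (W x).rank = N) :
    ∃ (lam : Fin N → ℝ) (v : Fin N → Fin k → ℂ),
      ∑ x ∈ s, VectorMeasure.dirac x (W x) = rankOneSum lam v := by
  choose! v hv using fun x (hx : x ∈ s) => exists_eq_sum_vecMulVec_of_posSemidef (hW x hx)
  let I := Σ x : s, Fin (W x).rank
  have hcard : Fintype.card I = N := by
    rw [Fintype.card_sigma, ← hN, ← Finset.sum_coe_sort s fun x => (W x).rank]
    simp
  let e : Fin N ≃ I := (finCongr hcard.symm).trans (Fintype.equivFin I).symm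
  refine ⟨fun l => (e l).1, fun l => v (e l).1 (e l).2, ?_⟩
  rw [rankOneSum, e.sum_comp (fun i : I =>
    VectorMeasure.dirac (i.1 : ℝ) (vecMulVec (v i.1 i.2) (star (v i.1 i.2)))),
    Fintype.sum_sigma, ← Finset.sum_coe_sort s]
  exact Finset.sum_congr rfl fun x _ => (congrArg _ (hv x x.2)).trans (dirac_sum _ _ _)

end RankOneDecomposition

/-! ### Krylov matrices and the dimensions of the null spaces -/

section Krylov

variable {ι R : Type*} [Fintype ι] [DecidableEq ι] [CommRing R] {k : ℕ}

/-- The Krylov matrix `(E, T E, …, T^{d-1} E)`. -/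
def krylov (T : Matrix ι ι R) (E : Matrix ι (Fin k) R) (d : ℕ) : Matrix ι (Fin (d * k)) R :=
  Matrix.of fun i c => (T ^ (c.divNat : ℕ) * E) i c.modNat

/-- The vector polynomial of degree less than `d` whose coefficients are the successive blocks of
`k` entries of a vector of length `d * k`. -/
def vecPoly [DecidableEq R] (k d : ℕ) : (Fin (d * k) → R) →ₗ[R] (Fin k → R[X]) :=
  LinearMap.pi fun a => ofFn d ∘ₗ LinearMap.funLeft R R fun i => finProdFinEquiv (i, a)

section VecPoly

variable [DecidableEq R]

theorem vecPoly_apply (d : ℕ) (x : Fin (d * k) → R) (a : Fin k) :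
    vecPoly k d x a = ofFn d fun i => x (finProdFinEquiv (i, a)) := rfl

theorem vecPoly_injective (k d : ℕ) : Function.Injective (vecPoly (R := R) k d) := by
  intro x y h
  funext c
  obtain ⟨⟨i, a⟩, rfl⟩ := finProdFinEquiv.surjective c
  exact congrFun (injective_ofFn d (congrFun h a)) i

theorem exists_vecPoly_eq_iff {d : ℕ} {p : Fin k → R[X]} :
    (∃ x, vecPoly k (d + 1) x = p) ↔ ∀ a, (p a).natDegree ≤ d := by
  constructor
  · rintro ⟨x, rfl⟩ a
    exact Nat.le_of_lt_succ (ofFn_natDegree_lt (Nat.succ_pos d) _)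
  · intro hp
    refine ⟨fun c => toFn (d + 1) (p (finProdFinEquiv.symm c).2) (finProdFinEquiv.symm c).1,
      funext fun a => ?_⟩
    rw [vecPoly_apply]
    simp only [Equiv.symm_apply_apply]
    exact ofFn_comp_toFn_eq_id_of_natDegree_lt (Nat.lt_succ_of_le (hp a))

theorem vecEval_vecPoly (T : Matrix ι ι R) (E : Matrix ι (Fin k) R) (d : ℕ)
    (x : Fin (d * k) → R) : vecEval T E (vecPoly k d x) = krylov T E d *ᵥ x := by
  have hkrylov : ∀ l i a, krylov T E d l (finProdFinEquiv (i, a)) = (T ^ (i : ℕ) *ᵥ E.col a) l := by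
    intro l i a
    have hdiv := finProdFinEquiv.symm_apply_apply (i, a)
    rw [finProdFinEquiv_symm_apply, Prod.mk.injEq] at hdiv
    rw [krylov, Matrix.of_apply, hdiv.1, hdiv.2]
    rfl
  funext l
  rw [vecEval_apply, mulVec, dotProduct, ← finProdFinEquiv.sum_comp, Fintype.sum_prod_type_right,
    Finset.sum_apply]
  refine Finset.sum_congr rfl fun a _ => ?_
  simp only [vecPoly_apply, ofFn_eq_sum_monomial, map_sum, aeval_monomial, ← Algebra.smul_def,
    Matrix.sum_mulVec, Finset.sum_apply, Matrix.smul_mulVec, Pi.smul_apply, smul_eq_mul, hkrylov,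
    mul_comm]

end VecPoly

theorem mul_krylov_of_mul_eq_mul {ι' : Type*} [Fintype ι'] [DecidableEq ι'] {T : Matrix ι ι R}
    {T' : Matrix ι' ι' R} {S : Matrix ι' ι R} (h : T' * S = S * T) (E : Matrix ι (Fin k) R)
    (d : ℕ) : S * krylov T E d = krylov T' (S * E) d := by
  ext i c
  rw [krylov, krylov, Matrix.of_apply, ← Matrix.mul_assoc,
    pow_mul_eq_mul_pow_of_mul_eq_mul h, Matrix.mul_assoc]
  rfl

end Krylov

namespace IsModel

variable {ι : Type*} [Fintype ι] [DecidableEq ι] {k : ℕ} {T : Matrix ι ι ℂ}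
  {E : Matrix ι (Fin k) ℂ} {μ : MatMeasure k}

theorem mem_nullPolys (h : IsModel T E μ) {d : ℕ} {p : Fin k → ℂ[X]} :
    p ∈ nullPolys μ d ↔ (∀ a, (p a).natDegree ≤ d) ∧ vecEval T E p = 0 := by
  rw [nullPolys, Set.mem_ofPred_eq, h, conjTranspose_mul_self_eq_zero]
  refine and_congr_right fun _ => ⟨fun h0 => ?_, fun h0 => ?_⟩
  · funext i
    exact congrFun₂ h0 i 0
  · ext i _
    exact congrFun h0 i

theorem nullPolys_eq_map_ker (h : IsModel T E μ) (d : ℕ) :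
    nullPolys μ d =
      ((LinearMap.ker (krylov T E (d + 1)).mulVecLin).map (vecPoly k (d + 1)) :
        Set (Fin k → ℂ[X])) := by
  ext p
  rw [h.mem_nullPolys, ← exists_vecPoly_eq_iff]
  constructor
  · rintro ⟨⟨x, rfl⟩, hx⟩
    exact ⟨x, (vecEval_vecPoly T E (d + 1) x).symm.trans hx, rfl⟩
  · rintro ⟨x, hx, rfl⟩
    exact ⟨⟨x, rfl⟩, (vecEval_vecPoly T E (d + 1) x).trans hx⟩

theorem finrank_nullPolys (h : IsModel T E μ) (d : ℕ) :
    Set.finrank ℂ (nullPolys μ d) + (krylov T E (d + 1)).rank = (d + 1) * k := by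
  rw [Set.finrank, h.nullPolys_eq_map_ker, Submodule.span_eq,
    (Submodule.equivMapOfInjective _ (vecPoly_injective k (d + 1)) _).symm.finrank_eq,
    add_comm, Matrix.rank, LinearMap.finrank_range_add_finrank_ker, Module.finrank_fin_fun]

end IsModel

/-! ### The spectral measure -/

section SpectralMap

variable {k N : ℕ}

/-- The first `k` columns of the identity matrix: the spectral map records the components of the
eigenvectors along these coordinate vectors. -/
def headCols (hkN : k ≤ N) : Matrix (Fin N) (Fin k) ℂ :=
  (1 : Matrix (Fin N) (Fin N) ℂ).submatrix id (Fin.castLE hkN)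

theorem mul_headCols {m : Type*} (hkN : k ≤ N) (M : Matrix m (Fin N) ℂ) :
    M * headCols hkN = M.submatrix id (Fin.castLE hkN) :=
  mul_submatrix_one (Equiv.refl _) _ _

theorem conjTranspose_headCols_mulVec (hkN : k ≤ N) (w : Fin N → ℂ) :
    (headCols hkN)ᴴ *ᵥ w = w ∘ Fin.castLE hkN := by
  rw [headCols, conjTranspose_submatrix, conjTranspose_one]
  exact (submatrix_mulVec_equiv _ w _ (Equiv.refl _)).trans (by rw [one_mulVec]; rfl)

theorem spectralMap_eq (hkN : k ≤ N) {J : Matrix (Fin N) (Fin N) ℂ} (hJ : J.IsHermitian) :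
    spectralMap hkN J = rankOneSum hJ.eigenvalues (eigenvectorHead hkN hJ) :=
  dif_pos hJ

theorem isModel_spectralMap (hkN : k ≤ N) {J : Matrix (Fin N) (Fin N) ℂ} (hJ : J.IsHermitian) :
    IsModel J (headCols hkN) (spectralMap hkN J) := by
  let U : Matrix (Fin N) (Fin N) ℂ := hJ.eigenvectorUnitary
  have hUU : Uᴴ * U = 1 := Unitary.coe_star_mul_self hJ.eigenvectorUnitary
  have hUU' : U * Uᴴ = 1 := Unitary.coe_mul_star_self hJ.eigenvectorUnitary
  have hdiag : J * U = U * diagonal fun l => (hJ.eigenvalues l : ℂ) := by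
    have hspec : J = U * diagonal (fun l => (hJ.eigenvalues l : ℂ)) * Uᴴ := hJ.spectral_theorem
    conv_lhs => rw [hspec]
    rw [Matrix.mul_assoc, hUU, Matrix.mul_one]
  have hheads : (Matrix.of fun l => star (eigenvectorHead hkN hJ l)) = Uᴴ * headCols hkN := by
    rw [mul_headCols]
    rfl
  rw [spectralMap_eq hkN hJ]
  have hmodel := (isModel_rankOneSum hJ.eigenvalues (eigenvectorHead hkN hJ)).mul_of_mul_eq_mul
    hdiag hUU
  rwa [hheads, ← Matrix.mul_assoc, hUU', Matrix.one_mul] at hmodel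

end SpectralMap

/-! ### Blocks -/

section Blocks

variable {k N : ℕ}

theorem lt_numBlocks_iff (hk : 0 < k) {j : ℕ} : j < numBlocks k N ↔ j * k < N := by
  rw [← not_le, ← not_le, numBlocks, ceilDiv_le_iff_le_mul hk, mul_comm]

theorem le_numBlocks_mul (hk : 0 < k) : N ≤ numBlocks k N * k :=
  not_lt.1 fun h => lt_irrefl _ ((lt_numBlocks_iff hk).2 h)

theorem blockSize_eq (hk : 0 < k) {j : ℕ} (h : j + 1 < numBlocks k N) : blockSize k N j = k := by
  rw [lt_numBlocks_iff hk, add_mul, one_mul] at h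
  exact min_eq_left (by omega)

theorem blockSize_zero (hkN : k ≤ N) : blockSize k N 0 = k := by
  rwa [blockSize, Nat.zero_mul, Nat.sub_zero, min_eq_left_iff]

theorem blockSize_succ_le (k N j : ℕ) : blockSize k N (j + 1) ≤ blockSize k N j :=
  min_le_min_left _ (Nat.sub_le_sub_left (Nat.mul_le_mul_right k j.le_succ) N)

theorem lt_numBlocks (hk : 0 < k) {j : ℕ} (a : Fin (blockSize k N j)) : j < numBlocks k N := by
  have h : (a : ℕ) < N - j * k := a.isLt.trans_le (min_le_right _ _)
  rw [lt_numBlocks_iff hk]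
  omega

theorem isEmpty_block (hk : 0 < k) {j : ℕ} (h : ¬ j < numBlocks k N) :
    IsEmpty (Fin (blockSize k N j)) :=
  ⟨fun a => h (lt_numBlocks hk a)⟩

theorem val_blockIndex {j : ℕ} (a : Fin (blockSize k N j)) :
    (blockIndex k N j a : ℕ) = j * k + a := rfl

theorem blockIndex_div {j : ℕ} (a : Fin (blockSize k N j)) : (blockIndex k N j a : ℕ) / k = j := by
  have ha : (a : ℕ) < k := a.isLt.trans_le (blockSize_le k N j)
  rw [val_blockIndex, mul_comm, Nat.mul_add_div (Nat.zero_lt_of_lt ha), Nat.div_eq_of_lt ha,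
    add_zero]

theorem blockIndex_injective (j : ℕ) : Function.Injective (blockIndex k N j) := fun _ _ h =>
  Fin.ext (Nat.add_left_cancel (congrArg Fin.val h))

theorem exists_blockIndex_eq (hk : 0 < k) (r : Fin N) :
    ∃ j, ∃ a : Fin (blockSize k N j), blockIndex k N j a = r := by
  have hdiv : (r : ℕ) / k * k + r % k = r := Nat.div_add_mod' r k
  have hlt : (r : ℕ) % k < blockSize k N (r / k) :=
    lt_min (Nat.mod_lt _ hk) (by have := r.isLt; omega)
  exact ⟨r / k, ⟨r % k, hlt⟩, Fin.ext hdiv⟩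

theorem mul_blockSel {m : Type*} (M : Matrix m (Fin N) ℂ) (j : ℕ) :
    M * blockSel k N j = M.submatrix id (blockIndex k N j) :=
  mul_submatrix_one (Equiv.refl _) _ _

theorem conjTranspose_blockSel_mul {m : Type*} (M : Matrix (Fin N) m ℂ) (j : ℕ) :
    (blockSel k N j)ᴴ * M = M.submatrix (blockIndex k N j) id := by
  rw [← conjTranspose_conjTranspose M, ← conjTranspose_mul, mul_blockSel]
  rfl

theorem conjTranspose_blockSel_mul_self (j : ℕ) : (blockSel k N j)ᴴ * blockSel k N j = 1 := by
  rw [conjTranspose_blockSel_mul, blockSel, submatrix_submatrix]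
  exact submatrix_one _ (blockIndex_injective j)

theorem conjTranspose_blockSel_mul_of_ne {i j : ℕ} (h : i ≠ j) :
    (blockSel k N i)ᴴ * blockSel k N j = 0 := by
  rw [conjTranspose_blockSel_mul]
  ext a b
  refine one_apply_ne fun hab => h ?_
  rw [← blockIndex_div a, ← blockIndex_div b]
  exact congrArg (fun r : Fin N => (r : ℕ) / k) hab

theorem conjTranspose_blockSel_mul_blockSel_mul {m : Type*} (j : ℕ)
    (M : Matrix (Fin (blockSize k N j)) m ℂ) :
    (blockSel k N j)ᴴ * (blockSel k N j * M) = M := by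
  rw [← Matrix.mul_assoc, conjTranspose_blockSel_mul_self, Matrix.one_mul]

theorem conjTranspose_blockSel_mul_blockSel_mul_of_ne {m : Type*} {i j : ℕ} (h : i ≠ j)
    (M : Matrix (Fin (blockSize k N j)) m ℂ) : (blockSel k N i)ᴴ * (blockSel k N j * M) = 0 := by
  rw [← Matrix.mul_assoc, conjTranspose_blockSel_mul_of_ne h, Matrix.zero_mul]

theorem eq_of_forall_conjTranspose_blockSel_mul_eq {m : Type*} (hk : 0 < k)
    {M M' : Matrix (Fin N) m ℂ}
    (h : ∀ j < numBlocks k N, (blockSel k N j)ᴴ * M = (blockSel k N j)ᴴ * M') : M = M' := by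
  ext r c
  obtain ⟨j, a, rfl⟩ := exists_blockIndex_eq hk r
  simpa only [conjTranspose_blockSel_mul, submatrix_apply, id] using
    congrFun₂ (h j (lt_numBlocks hk a)) a c

theorem blockSel_mul_conjTranspose_blockSel_mul {m : Type*} (hk : 0 < k) {M : Matrix (Fin N) m ℂ}
    {j : ℕ} (h : ∀ i < numBlocks k N, i ≠ j → (blockSel k N i)ᴴ * M = 0) :
    blockSel k N j * ((blockSel k N j)ᴴ * M) = M := by
  refine eq_of_forall_conjTranspose_blockSel_mul_eq hk fun i hi => ?_
  obtain rfl | hij := eq_or_ne i j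
  · rw [conjTranspose_blockSel_mul_blockSel_mul]
  · rw [conjTranspose_blockSel_mul_blockSel_mul_of_ne hij, h i hi hij]

variable (k) in
/-- The `(i, j)` block of an `N × N` matrix. -/
def block (M : Matrix (Fin N) (Fin N) ℂ) (i j : ℕ) :
    Matrix (Fin (blockSize k N i)) (Fin (blockSize k N j)) ℂ :=
  M.submatrix (blockIndex k N i) (blockIndex k N j)

theorem conjTranspose_blockSel_mul_mul_blockSel (M : Matrix (Fin N) (Fin N) ℂ) (i j : ℕ) :
    (blockSel k N i)ᴴ * (M * blockSel k N j) = block k M i j := by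
  rw [mul_blockSel, conjTranspose_blockSel_mul]
  rfl

theorem conjTranspose_block (M : Matrix (Fin N) (Fin N) ℂ) (i j : ℕ) :
    (block k M i j)ᴴ = block k Mᴴ j i := rfl

theorem eq_of_isHermitian_of_forall_block_eq (hk : 0 < k) {M M' : Matrix (Fin N) (Fin N) ℂ}
    (hM : M.IsHermitian) (hM' : M'.IsHermitian)
    (h : ∀ i j, j ≤ i → block k M i j = block k M' i j) : M = M' := by
  have hblock : ∀ i j, block k M i j = block k M' i j := fun i j => by
    obtain hji | hij := le_total j i
    · exact h i j hji
    · rw [← hM, ← hM', ← conjTranspose_block, ← conjTranspose_block, h j i hij]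
  ext r c
  obtain ⟨i, a, rfl⟩ := exists_blockIndex_eq hk r
  obtain ⟨j, b, rfl⟩ := exists_blockIndex_eq hk c
  exact congrFun₂ (hblock i j) a b

end Blocks

section BlockTridiag

variable {k N : ℕ} (A : ∀ j, Matrix (Fin (blockSize k N j)) (Fin (blockSize k N j)) ℂ)
  (B : ∀ j, Matrix (Fin (blockSize k N (j + 1))) (Fin (blockSize k N j)) ℂ)

theorem blockTridiag_eq_sum (hk : 0 < k) :
    blockTridiag k N A B = ∑ j ∈ Finset.range (numBlocks k N),
      (blockSel k N j * A j * (blockSel k N j)ᴴ + blockSel k N (j + 1) * B j * (blockSel k N j)ᴴ +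
        blockSel k N j * (B j)ᴴ * (blockSel k N (j + 1))ᴴ) := by
  simp only [blockTridiag, add_assoc]
  rw [Finset.sum_add_distrib (s := Finset.range (numBlocks k N))]
  congr 1
  refine Finset.sum_subset (Finset.range_mono (Nat.sub_le _ _)) fun j _ hj => ?_
  have hempty : IsEmpty (Fin (blockSize k N (j + 1))) :=
    isEmpty_block hk fun h => hj (Finset.mem_range.2 (Nat.lt_sub_of_add_lt h))
  have hB : B j = 0 := Matrix.ext fun a => hempty.elim a
  rw [hB, conjTranspose_zero, Matrix.mul_zero, Matrix.mul_zero, Matrix.zero_mul, Matrix.zero_mul,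
    add_zero]

theorem blockTridiag_mul_blockSel_zero (hk : 0 < k) :
    blockTridiag k N A B * blockSel k N 0 = blockSel k N 0 * A 0 + blockSel k N 1 * B 0 := by
  by_cases hn : 0 < numBlocks k N
  · rw [blockTridiag_eq_sum A B hk, Matrix.sum_mul,
      Finset.sum_eq_single_of_mem 0 (Finset.mem_range.2 hn)]
    · simp only [Matrix.add_mul, Matrix.mul_assoc, conjTranspose_blockSel_mul_self,
        conjTranspose_blockSel_mul_of_ne (Nat.succ_ne_self 0), Matrix.mul_one, Matrix.mul_zero,
        add_zero]
    · intro j _ hj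
      simp only [Matrix.add_mul, Matrix.mul_assoc, conjTranspose_blockSel_mul_of_ne hj,
        conjTranspose_blockSel_mul_of_ne (Nat.succ_ne_zero j), Matrix.mul_zero, add_zero]
  · ext r a
    exact (isEmpty_block hk hn).elim a

theorem blockTridiag_mul_blockSel_succ (hk : 0 < k) (j : ℕ) :
    blockTridiag k N A B * blockSel k N (j + 1) =
      blockSel k N (j + 1) * A (j + 1) + blockSel k N (j + 2) * B (j + 1) +
        blockSel k N j * (B j)ᴴ := by
  by_cases hj : j + 1 < numBlocks k N
  · rw [blockTridiag_eq_sum A B hk, Matrix.sum_mul,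
      Finset.sum_eq_add_of_mem (j + 1) j (Finset.mem_range.2 hj)
        (Finset.mem_range.2 (Nat.lt_of_succ_lt hj)) j.succ_ne_self]
    · simp only [Matrix.add_mul, Matrix.mul_assoc, conjTranspose_blockSel_mul_self,
        conjTranspose_blockSel_mul_of_ne (Nat.succ_ne_self (j + 1)),
        conjTranspose_blockSel_mul_of_ne (Nat.succ_ne_self j).symm, Matrix.mul_one,
        Matrix.mul_zero, add_zero, zero_add]
    · rintro i _ ⟨hi, hij⟩
      simp only [Matrix.add_mul, Matrix.mul_assoc, conjTranspose_blockSel_mul_of_ne hi,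
        conjTranspose_blockSel_mul_of_ne (fun h => hij (Nat.succ_injective h)), Matrix.mul_zero,
        add_zero]
  · ext r a
    exact (isEmpty_block hk hj).elim a

theorem block_blockTridiag_self (hk : 0 < k) (j : ℕ) :
    block k (blockTridiag k N A B) j j = A j := by
  rw [← conjTranspose_blockSel_mul_mul_blockSel]
  cases j with
  | zero =>
    rw [blockTridiag_mul_blockSel_zero A B hk, Matrix.mul_add,
      conjTranspose_blockSel_mul_blockSel_mul,
      conjTranspose_blockSel_mul_blockSel_mul_of_ne (by omega), add_zero]
  | succ j =>
    rw [blockTridiag_mul_blockSel_succ A B hk, Matrix.mul_add, Matrix.mul_add,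
      conjTranspose_blockSel_mul_blockSel_mul,
      conjTranspose_blockSel_mul_blockSel_mul_of_ne (by omega),
      conjTranspose_blockSel_mul_blockSel_mul_of_ne (by omega), add_zero, add_zero]

theorem block_blockTridiag_succ (hk : 0 < k) (j : ℕ) :
    block k (blockTridiag k N A B) (j + 1) j = B j := by
  rw [← conjTranspose_blockSel_mul_mul_blockSel]
  cases j with
  | zero =>
    rw [blockTridiag_mul_blockSel_zero A B hk, Matrix.mul_add,
      conjTranspose_blockSel_mul_blockSel_mul_of_ne (by omega),
      conjTranspose_blockSel_mul_blockSel_mul]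
    exact zero_add _
  | succ j =>
    rw [blockTridiag_mul_blockSel_succ A B hk, Matrix.mul_add, Matrix.mul_add,
      conjTranspose_blockSel_mul_blockSel_mul_of_ne (by omega),
      conjTranspose_blockSel_mul_blockSel_mul,
      conjTranspose_blockSel_mul_blockSel_mul_of_ne (by omega), zero_add, add_zero]

theorem block_blockTridiag_eq_zero (hk : 0 < k) {i j : ℕ} (h : j + 1 < i) :
    block k (blockTridiag k N A B) i j = 0 := by
  rw [← conjTranspose_blockSel_mul_mul_blockSel]
  cases j with
  | zero =>
    rw [blockTridiag_mul_blockSel_zero A B hk, Matrix.mul_add,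
      conjTranspose_blockSel_mul_blockSel_mul_of_ne (by omega),
      conjTranspose_blockSel_mul_blockSel_mul_of_ne (by omega), add_zero]
  | succ j =>
    rw [blockTridiag_mul_blockSel_succ A B hk, Matrix.mul_add, Matrix.mul_add,
      conjTranspose_blockSel_mul_blockSel_mul_of_ne (by omega),
      conjTranspose_blockSel_mul_blockSel_mul_of_ne (by omega),
      conjTranspose_blockSel_mul_blockSel_mul_of_ne (by omega), add_zero, add_zero]

theorem blockTridiag_apply_eq_zero (hk : 0 < k) {r c : Fin N}
    (h : (c : ℕ) / k + 1 < (r : ℕ) / k) : blockTridiag k N A B r c = 0 := by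
  obtain ⟨i, a, rfl⟩ := exists_blockIndex_eq hk r
  obtain ⟨j, b, rfl⟩ := exists_blockIndex_eq hk c
  rw [blockIndex_div, blockIndex_div] at h
  exact congrFun₂ (block_blockTridiag_eq_zero A B hk h) a b

variable {A B}

theorem isHermitian_blockTridiag (hA : ∀ j < numBlocks k N, (A j).IsHermitian) :
    (blockTridiag k N A B).IsHermitian := by
  rw [IsHermitian, blockTridiag, conjTranspose_add, conjTranspose_sum, conjTranspose_sum]
  congr 1
  · refine Finset.sum_congr rfl fun j hj => ?_
    simp only [conjTranspose_mul, conjTranspose_conjTranspose, (hA j (Finset.mem_range.1 hj)).eq,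
      Matrix.mul_assoc]
  · refine Finset.sum_congr rfl fun j _ => ?_
    simp only [conjTranspose_add, conjTranspose_mul, conjTranspose_conjTranspose,
      Matrix.mul_assoc, add_comm]

theorem eq_blockTridiag_of_isHermitian (hk : 0 < k) {J : Matrix (Fin N) (Fin N) ℂ}
    (hJ : J.IsHermitian) (h : ∀ i j, j + 1 < i → block k J i j = 0) :
    J = blockTridiag k N (fun j => block k J j j) (fun j => block k J (j + 1) j) := by
  refine eq_of_isHermitian_of_forall_block_eq hk hJ
    (isHermitian_blockTridiag fun j _ => hJ.submatrix _) fun i j hji => ?_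
  obtain rfl | rfl | hij : i = j ∨ i = j + 1 ∨ j + 1 < i := by omega
  · rw [block_blockTridiag_self _ _ hk]
  · rw [block_blockTridiag_succ _ _ hk]
  · rw [h i j hij, block_blockTridiag_eq_zero _ _ hk hij]

end BlockTridiag

/-! ### The three-term recurrence -/

section Degree

section Coefficients

variable {R l m n : Type*} [Semiring R] [Fintype m]

theorem natDegree_mul_map_C_le {d : ℕ} {F : Matrix l m R[X]} (hF : ∀ a b, (F a b).natDegree ≤ d)
    (M : Matrix m n R) (a : l) (b : n) :
    ((F * M.map C) a b).natDegree ≤ d := by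
  rw [Matrix.mul_apply]
  exact natDegree_sum_le_of_forall_le _ _ fun c _ => (natDegree_mul_C_le _ _).trans (hF a c)

theorem coeff_mul_map_C (F : Matrix l m R[X]) (M : Matrix m n R) (d : ℕ) :
    (F * M.map C).map (fun p => p.coeff d) = F.map (fun p => p.coeff d) * M := by
  ext a b
  simp only [Matrix.map_apply, Matrix.mul_apply, finsetSum_coeff, coeff_mul_C]

end Coefficients

variable {k N : ℕ} {P : ∀ j, Matrix (Fin k) (Fin (blockSize k N j)) ℂ[X]} {j : ℕ}
  (A : ∀ j, Matrix (Fin (blockSize k N j)) (Fin (blockSize k N j)) ℂ)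
  (B : ∀ j, Matrix (Fin (blockSize k N (j + 1))) (Fin (blockSize k N j)) ℂ)

theorem exists_residual_eq_X_smul_sub (hP : ∀ i ≤ j, ∀ a b, (P i a b).natDegree ≤ i) :
    ∃ G : Matrix (Fin k) (Fin (blockSize k N j)) ℂ[X],
      (∀ a b, (G a b).natDegree ≤ j) ∧ residual P A B j = (X : ℂ[X]) • P j - G := by
  cases j with
  | zero => exact ⟨_, natDegree_mul_map_C_le (hP 0 le_rfl) (A 0), rfl⟩
  | succ j =>
    refine ⟨P (j + 1) * (A (j + 1)).map C + P j * (B j)ᴴ.map C, fun a b => ?_, sub_sub _ _ _⟩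
    exact natDegree_add_le_of_degree_le (natDegree_mul_map_C_le (hP (j + 1) le_rfl) _ a b)
      ((natDegree_mul_map_C_le (hP j j.le_succ) _ a b).trans j.le_succ)

theorem natDegree_residual_le (hP : ∀ i ≤ j, ∀ a b, (P i a b).natDegree ≤ i) (a : Fin k)
    (b : Fin (blockSize k N j)) : (residual P A B j a b).natDegree ≤ j + 1 := by
  obtain ⟨G, hG, h⟩ := exists_residual_eq_X_smul_sub A B hP
  rw [h, Matrix.sub_apply, Matrix.smul_apply, smul_eq_mul]
  refine (natDegree_sub_le _ _).trans (max_le ?_ ((hG a b).trans j.le_succ))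
  rw [add_comm]
  exact natDegree_mul_le_of_le natDegree_X_le (hP j le_rfl a b)

theorem coeff_residual (hP : ∀ i ≤ j, ∀ a b, (P i a b).natDegree ≤ i) :
    (residual P A B j).map (fun p => p.coeff (j + 1)) = (P j).map fun p => p.coeff j := by
  obtain ⟨G, hG, h⟩ := exists_residual_eq_X_smul_sub A B hP
  ext a b
  rw [h, Matrix.map_apply, Matrix.map_apply, Matrix.sub_apply, Matrix.smul_apply, smul_eq_mul,
    coeff_sub, coeff_X_mul, coeff_eq_zero_of_natDegree_lt (Nat.lt_succ_of_le (hG a b)), sub_zero]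

end Degree

section Band

variable {k N : ℕ} {J : Matrix (Fin N) (Fin N) ℂ}

theorem pow_mul_headCols_apply_eq_zero (hkN : k ≤ N)
    (hJ : ∀ r c : Fin N, (c : ℕ) / k + 1 < (r : ℕ) / k → J r c = 0) {d : ℕ} {r : Fin N}
    (hr : d < (r : ℕ) / k) (a : Fin k) : (J ^ d * headCols hkN) r a = 0 := by
  induction d generalizing r with
  | zero =>
    rw [pow_zero, Matrix.one_mul]
    refine one_apply_ne fun h : r = Fin.castLE hkN a => hr.ne' ?_
    rw [h]
    exact Nat.div_eq_of_lt a.isLt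
  | succ d ih =>
    rw [pow_succ', Matrix.mul_assoc, Matrix.mul_apply]
    refine Finset.sum_eq_zero fun c _ => ?_
    obtain hc | hc := lt_or_ge d ((c : ℕ) / k)
    · rw [ih hc, mul_zero]
    · rw [hJ r c (by omega), zero_mul]

theorem polyEval_headCols_apply_eq_zero {m : Type*} (hkN : k ≤ N)
    (hJ : ∀ r c : Fin N, (c : ℕ) / k + 1 < (r : ℕ) / k → J r c = 0) {d : ℕ}
    {F : Matrix (Fin k) m ℂ[X]} {b : m} (hF : ∀ a, (F a b).natDegree ≤ d) {r : Fin N}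
    (hr : d < (r : ℕ) / k) : polyEval J (headCols hkN) F r b = 0 := by
  rw [polyEval_apply, vecEval_apply, Finset.sum_apply]
  refine Finset.sum_eq_zero fun a _ => ?_
  rw [col_apply, aeval_eq_sum_range' (Nat.lt_succ_of_le (hF a)), sum_mulVec, Finset.sum_apply]
  refine Finset.sum_eq_zero fun l hl => ?_
  have hpow : (J ^ l *ᵥ (headCols hkN).col a) r = 0 :=
    pow_mul_headCols_apply_eq_zero hkN hJ ((Finset.mem_range_succ_iff.1 hl).trans_lt hr) a
  rw [smul_mulVec, Pi.smul_apply, hpow, smul_zero]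

end Band

section Recurrence

variable {k N : ℕ}

/-- The polynomials `P 0 = I`, `P (j+1) = (x P j - P j A j - P (j-1) (B (j-1))ᴴ) (B j)†` of the
three-term recurrence with coefficients `A`, `B`. -/
def recPoly (A : ∀ j, Matrix (Fin (blockSize k N j)) (Fin (blockSize k N j)) ℂ)
    (B : ∀ j, Matrix (Fin (blockSize k N (j + 1))) (Fin (blockSize k N j)) ℂ) :
    ∀ j, Matrix (Fin k) (Fin (blockSize k N j)) ℂ[X]
  | 0 => (1 : Matrix (Fin k) (Fin k) ℂ[X]).submatrix id (Fin.castLE (blockSize_le k N 0))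
  | 1 => ((X : ℂ[X]) • recPoly A B 0 - recPoly A B 0 * (A 0).map C) * (rightInv (B 0)).map C
  | j + 2 => ((X : ℂ[X]) • recPoly A B (j + 1) - recPoly A B (j + 1) * (A (j + 1)).map C -
      recPoly A B j * (B j)ᴴ.map C) * (rightInv (B (j + 1))).map C

/-- The subdiagonal blocks `B 0, …, B (n-2)` have full row rank. -/
def HasFullRank (B : ∀ j, Matrix (Fin (blockSize k N (j + 1))) (Fin (blockSize k N j)) ℂ) : Prop :=
  ∀ j, j + 1 < numBlocks k N → (B j).rank = blockSize k N (j + 1)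

variable (A : ∀ j, Matrix (Fin (blockSize k N j)) (Fin (blockSize k N j)) ℂ)
  (B : ∀ j, Matrix (Fin (blockSize k N (j + 1))) (Fin (blockSize k N j)) ℂ)

theorem recPoly_zero :
    recPoly A B 0 =
      (1 : Matrix (Fin k) (Fin k) ℂ[X]).submatrix id (Fin.castLE (blockSize_le k N 0)) := by
  rw [recPoly]

theorem recPoly_succ (j : ℕ) :
    recPoly A B (j + 1) = residual (recPoly A B) A B j * (rightInv (B j)).map C := by
  cases j <;> simp only [recPoly, residual]

theorem natDegree_recPoly_le (j : ℕ) (a : Fin k) (b : Fin (blockSize k N j)) :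
    (recPoly A B j a b).natDegree ≤ j := by
  induction j using Nat.strong_induction_on generalizing a with
  | _ j ih =>
  cases j with
  | zero =>
    rw [recPoly_zero, submatrix_apply, Matrix.one_apply]
    split_ifs <;> simp
  | succ j =>
    rw [recPoly_succ]
    exact natDegree_mul_map_C_le
      (natDegree_residual_le A B fun i hi a b => ih i (Nat.lt_succ_of_le hi) a b) _ a b

variable {A B}

theorem polyEval_one_submatrix_castLE (J : Matrix (Fin N) (Fin N) ℂ) (hkN : k ≤ N) :
    polyEval J (headCols hkN)
      ((1 : Matrix (Fin k) (Fin k) ℂ[X]).submatrix id (Fin.castLE (blockSize_le k N 0))) =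
      blockSel k N 0 := by
  rw [polyEval_submatrix, polyEval_one, headCols, submatrix_submatrix, blockSel]
  congr 1
  funext a
  exact Fin.ext (by simp [blockIndex])

theorem polyEval_residual (hk : 0 < k) (hkN : k ≤ N)
    {P : ∀ j, Matrix (Fin k) (Fin (blockSize k N j)) ℂ[X]}
    {A' : ∀ j, Matrix (Fin (blockSize k N j)) (Fin (blockSize k N j)) ℂ}
    {B' : ∀ j, Matrix (Fin (blockSize k N (j + 1))) (Fin (blockSize k N j)) ℂ} {j : ℕ}
    (hP : ∀ i ≤ j, polyEval (blockTridiag k N A B) (headCols hkN) (P i) = blockSel k N i)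
    (hA : A' j = A j) (hB : ∀ i < j, B' i = B i) :
    polyEval (blockTridiag k N A B) (headCols hkN) (residual P A' B' j) =
      blockSel k N (j + 1) * B j := by
  cases j with
  | zero =>
    rw [residual, map_sub, polyEval_X_smul, polyEval_mul_map_C, hP 0 le_rfl, hA,
      blockTridiag_mul_blockSel_zero A B hk, add_sub_cancel_left]
  | succ j =>
    rw [residual, map_sub, map_sub, polyEval_X_smul, polyEval_mul_map_C, polyEval_mul_map_C,
      hP (j + 1) le_rfl, hP j j.le_succ, hA, hB j j.lt_succ_self,
      blockTridiag_mul_blockSel_succ A B hk]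
    abel

theorem polyEval_recPoly (hk : 0 < k) (hkN : k ≤ N) (hB : HasFullRank B) (j : ℕ) :
    polyEval (blockTridiag k N A B) (headCols hkN) (recPoly A B j) = blockSel k N j := by
  induction j using Nat.strong_induction_on with
  | _ j ih =>
  cases j with
  | zero => rw [recPoly_zero, polyEval_one_submatrix_castLE]
  | succ j =>
    by_cases hj : j + 1 < numBlocks k N
    · rw [recPoly_succ, polyEval_mul_map_C,
        polyEval_residual hk hkN (fun i hi => ih i (Nat.lt_succ_of_le hi)) rfl fun _ _ => rfl,
        Matrix.mul_assoc, mul_rightInv (hB j hj), Matrix.mul_one]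
    · ext r a
      exact (isEmpty_block hk hj).elim a

theorem single_mem_range_krylov (hk : 0 < k) (hkN : k ≤ N) (hB : HasFullRank B) {d : ℕ}
    {r : Fin N} (hr : (r : ℕ) < d * k) :
    Pi.single r 1 ∈
      LinearMap.range (krylov (blockTridiag k N A B) (headCols hkN) d).mulVecLin := by
  obtain ⟨j, a, rfl⟩ := exists_blockIndex_eq hk r
  have hjd : j < d := by rwa [← Nat.div_lt_iff_lt_mul hk, blockIndex_div] at hr
  obtain ⟨d, rfl⟩ := Nat.exists_eq_succ_of_ne_zero (Nat.ne_zero_of_lt hjd)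
  obtain ⟨x, hx⟩ := exists_vecPoly_eq_iff.2 fun b =>
    (natDegree_recPoly_le A B j b a).trans (Nat.le_of_lt_succ hjd)
  refine ⟨x, ?_⟩
  rw [mulVecLin_apply, ← vecEval_vecPoly, hx]
  funext l
  have heval := congrFun₂ (polyEval_recPoly (A := A) hk hkN hB j) l a
  rw [polyEval_apply] at heval
  refine heval.trans ?_
  rw [blockSel, submatrix_apply, id, Matrix.one_apply, Pi.single_apply]

theorem le_rank_krylov (hk : 0 < k) (hkN : k ≤ N) (hB : HasFullRank B) {d t : ℕ} (htN : t ≤ N)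
    (htd : t ≤ d * k) : t ≤ (krylov (blockTridiag k N A B) (headCols hkN) d).rank := by
  have hli : LinearIndependent ℂ fun i : Fin t => (Pi.single (Fin.castLE htN i) 1 : Fin N → ℂ) :=
    (Pi.linearIndependent_single_one (Fin N) ℂ).comp _ (Fin.castLE_injective htN)
  rw [← Fintype.card_fin t, ← finrank_span_eq_card hli, Matrix.rank]
  refine Submodule.finrank_mono (Submodule.span_le.2 ?_)
  rintro _ ⟨i, rfl⟩
  exact single_mem_range_krylov hk hkN hB (i.isLt.trans_le htd)

theorem rank_krylov_of_lt (hk : 0 < k) (hkN : k ≤ N) (hB : HasFullRank B) {d : ℕ}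
    (hd : d < numBlocks k N) :
    (krylov (blockTridiag k N A B) (headCols hkN) d).rank = d * k :=
  le_antisymm (rank_le_width _)
    (le_rank_krylov hk hkN hB ((lt_numBlocks_iff hk).1 hd).le le_rfl)

theorem rank_krylov_numBlocks (hk : 0 < k) (hkN : k ≤ N) (hB : HasFullRank B) :
    (krylov (blockTridiag k N A B) (headCols hkN) (numBlocks k N)).rank = N :=
  le_antisymm (rank_le_height _) (le_rank_krylov hk hkN hB le_rfl (le_numBlocks_mul hk))

end Recurrence

/-! ### Spectral measures of banded matrices -/

section Membership

theorem rank_sum_vecMulVec_star {ι m : Type*} [Fintype ι] [Fintype m] {v : ι → m → ℂ}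
    (hv : LinearIndependent ℂ v) :
    (∑ i, vecMulVec (v i) (star (v i))).rank = Fintype.card ι := by
  have hsum : ∑ i, vecMulVec (v i) (star (v i)) = (Matrix.of v)ᵀ * (Matrix.of v)ᵀᴴ := by
    ext a b
    rw [Matrix.sum_apply, Matrix.mul_apply]
    rfl
  rw [hsum, rank_self_mul_conjTranspose, rank_transpose, ← linearIndependent_row_iff_rank_eq]
  exact hv

theorem eq_zero_of_mulVec_eq_smul_of_conjTranspose_mulVec_eq_zero {ι : Type*} [Fintype ι]
    [DecidableEq ι] {k d : ℕ} {J : Matrix ι ι ℂ} (hJ : J.IsHermitian) {E : Matrix ι (Fin k) ℂ}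
    (hK : (krylov J E d).rank = Fintype.card ι) {x : ℂ} {w : ι → ℂ} (hw : J *ᵥ w = x • w)
    (h0 : Eᴴ *ᵥ w = 0) : w = 0 := by
  have hpow : ∀ i : ℕ, J ^ i *ᵥ w = x ^ i • w := fun i => by
    induction i with
    | zero => simp
    | succ i ih => rw [pow_succ', ← mulVec_mulVec, ih, mulVec_smul, hw, smul_smul, pow_succ]
  have hinj : Function.Injective (krylov J E d)ᴴ.mulVec :=
    mulVec_injective_iff_rank_eq.2 (by rw [rank_conjTranspose, hK])
  refine hinj ?_
  rw [mulVec_zero]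
  funext c
  suffices ((J ^ (c.divNat : ℕ) * E)ᴴ *ᵥ w) c.modNat = 0 from this
  rw [conjTranspose_mul, (hJ.pow _).eq, ← mulVec_mulVec, hpow, mulVec_smul, h0, smul_zero,
    Pi.zero_apply]

variable {k N : ℕ}

theorem linearIndependent_eigenvectorHead (hkN : k ≤ N) {J : Matrix (Fin N) (Fin N) ℂ}
    (hJ : J.IsHermitian) {d : ℕ} (hK : (krylov J (headCols hkN) d).rank = N) (x : ℝ) :
    LinearIndependent ℂ fun j : {j // hJ.eigenvalues j = x} => eigenvectorHead hkN hJ j := by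
  have hbasis : LinearIndependent ℂ
      fun j : {j // hJ.eigenvalues j = x} => (hJ.eigenvectorBasis j).ofLp :=
    (hJ.eigenvectorBasis.orthonormal.linearIndependent.comp _ Subtype.val_injective).map'
      (WithLp.linearEquiv 2 ℂ (Fin N → ℂ)).toLinearMap (LinearEquiv.ker _)
  have hspan : Submodule.span ℂ
      (Set.range fun j : {j // hJ.eigenvalues j = x} => (hJ.eigenvectorBasis j).ofLp) ≤
      Module.End.eigenspace (toLin' J) (x : ℂ) := by
    rw [Submodule.span_le]
    rintro _ ⟨⟨j, rfl⟩, rfl⟩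
    exact Module.End.mem_eigenspace_iff.2 (hJ.mulVec_eigenvectorBasis j)
  refine hbasis.map (f := LinearMap.funLeft ℂ ℂ (Fin.castLE hkN))
    (Submodule.disjoint_def.2 fun w hw h0 => ?_)
  have hJw : J *ᵥ w = (x : ℂ) • w := Module.End.mem_eigenspace_iff.1 (hspan hw)
  refine eq_zero_of_mulVec_eq_smul_of_conjTranspose_mulVec_eq_zero hJ
    (hK.trans (Fintype.card_fin N).symm) hJw ?_
  rw [conjTranspose_headCols_mulVec]
  exact h0

theorem sum_eigenvectorHead (hkN : k ≤ N) {J : Matrix (Fin N) (Fin N) ℂ} (hJ : J.IsHermitian) :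
    ∑ j, vecMulVec (eigenvectorHead hkN hJ j) (star (eigenvectorHead hkN hJ j)) = 1 := by
  have hUU : (hJ.eigenvectorUnitary : Matrix (Fin N) (Fin N) ℂ) *
      (hJ.eigenvectorUnitary : Matrix (Fin N) (Fin N) ℂ)ᴴ = 1 :=
    Unitary.coe_mul_star_self hJ.eigenvectorUnitary
  rw [← submatrix_one (Fin.castLE hkN) (Fin.castLE_injective hkN), ← hUU]
  ext a b
  rw [Matrix.sum_apply, submatrix_apply, Matrix.mul_apply]
  rfl

variable {A : ∀ j, Matrix (Fin (blockSize k N j)) (Fin (blockSize k N j)) ℂ}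
  {B : ∀ j, Matrix (Fin (blockSize k N (j + 1))) (Fin (blockSize k N j)) ℂ}

theorem exists_spectralMap_eq_sum_dirac (hkN : k ≤ N) {J : Matrix (Fin N) (Fin N) ℂ}
    (hJ : J.IsHermitian) {d : ℕ} (hK : (krylov J (headCols hkN) d).rank = N) :
    ∃ (s : Finset ℝ) (W : ℝ → Matrix (Fin k) (Fin k) ℂ),
      spectralMap hkN J = ∑ x ∈ s, VectorMeasure.dirac x (W x) ∧
      (∀ x ∈ s, (W x).PosSemidef) ∧ ∑ x ∈ s, W x = 1 ∧ ∑ x ∈ s, (W x).rank = N := by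
  classical
  let v := eigenvectorHead hkN hJ
  have hmaps : ∀ j ∈ Finset.univ, hJ.eigenvalues j ∈ Finset.univ.image hJ.eigenvalues :=
    fun j hj => Finset.mem_image_of_mem _ hj
  refine ⟨Finset.univ.image hJ.eigenvalues,
    fun x => ∑ j with hJ.eigenvalues j = x, vecMulVec (v j) (star (v j)), ?_, fun x _ => ?_, ?_, ?_⟩
  · rw [spectralMap_eq hkN hJ, rankOneSum, ← Finset.sum_fiberwise_of_maps_to hmaps]
    refine Finset.sum_congr rfl fun x _ => ?_
    rw [dirac_sum]
    refine Finset.sum_congr rfl fun j hj => ?_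
    rw [(Finset.mem_filter.1 hj).2]
  · exact posSemidef_sum _ fun j _ => posSemidef_vecMulVec_self_star _
  · rw [Finset.sum_fiberwise_of_maps_to hmaps fun j => vecMulVec (v j) (star (v j))]
    exact sum_eigenvectorHead hkN hJ
  · have hrank : ∀ x, (∑ j with hJ.eigenvalues j = x, vecMulVec (v j) (star (v j))).rank =
        (Finset.univ.filter (hJ.eigenvalues · = x)).card := fun x => by
      rw [Finset.sum_subtype (p := fun j => hJ.eigenvalues j = x) _ (by simp),
        rank_sum_vecMulVec_star (linearIndependent_eigenvectorHead hkN hJ hK x),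
        Fintype.card_subtype]
    rw [Finset.sum_congr rfl fun x _ => hrank x, ← Finset.card_eq_sum_card_fiberwise hmaps,
      Finset.card_univ, Fintype.card_fin]

theorem spectralMap_mem_measureClass (hk : 0 < k) (hkN : k ≤ N)
    (hA : ∀ j, j < numBlocks k N → (A j).IsHermitian) (hB : HasFullRank B) :
    spectralMap hkN (blockTridiag k N A B) ∈ measureClass k N := by
  have hJ := isHermitian_blockTridiag (B := B) hA
  have hmodel := isModel_spectralMap hkN hJ
  have hK := rank_krylov_numBlocks (A := A) hk hkN hB
  refine ⟨exists_spectralMap_eq_sum_dirac hkN hJ hK, fun d hd => ?_, fun d hd => ?_⟩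
  · have hdim := hmodel.finrank_nullPolys d
    rw [rank_krylov_of_lt hk hkN hB hd] at hdim
    exact Nat.add_eq_right.1 hdim
  · have hdim := hmodel.finrank_nullPolys d
    rw [hd, hK] at hdim
    exact Nat.eq_sub_of_add_eq hdim

end Membership

/-! ### Banded matrices are recurrence matrices of their spectral measures -/

section Normalization

open scoped MatrixOrder in
theorem exists_posDef_mul_self_eq {m : Type*} [Fintype m] {G : Matrix m m ℂ}
    (hG : G.PosDef) : ∃ R : Matrix m m ℂ, R.PosDef ∧ R * R = G := by
  classical
  have hsq : CFC.sqrt G * CFC.sqrt G = G := CFC.sqrt_mul_sqrt_self G hG.posSemidef.nonneg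
  have hunit : IsUnit (CFC.sqrt G) := isUnit_of_mul_isUnit_left (hsq.symm ▸ hG.isUnit)
  exact ⟨CFC.sqrt G, ((CFC.sqrt_nonneg G).posSemidef.posDef_iff_isUnit).2 hunit, hsq⟩

theorem exists_unitary_mul_inv_sqrt_gram_eq_one {r k : ℕ} (hr : r = k)
    {L : Matrix (Fin k) (Fin r) ℂ} {M : Matrix (Fin r) (Fin k) ℂ} (hLM : L * M = 1) :
    ∃ R Q : Matrix (Fin k) (Fin k) ℂ, R.PosDef ∧ R * R = Mᴴ * M ∧
      Q ∈ unitaryGroup (Fin k) ℂ ∧ M * (R⁻¹ * Q).submatrix id (Fin.castLE hr.le) = 1 := by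
  subst hr
  have hML : M * L = 1 := mul_eq_one_comm.1 hLM
  have hinj : Function.Injective M.mulVec := fun x y hxy => by
    simpa only [mulVec_mulVec, hLM, one_mulVec] using congrArg L.mulVec hxy
  obtain ⟨R, hR, hRR⟩ := exists_posDef_mul_self_eq (PosDef.conjTranspose_mul_self M hinj)
  refine ⟨R, R * L, hR, hRR, ?_, ?_⟩
  · rw [mem_unitaryGroup_iff', star_eq_conjTranspose, conjTranspose_mul, hR.isHermitian.eq,
      Matrix.mul_assoc, ← Matrix.mul_assoc R, hRR, Matrix.mul_assoc, hML, Matrix.mul_one,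
      ← conjTranspose_mul, hML, conjTranspose_one]
  · rw [nonsing_inv_mul_cancel_left _ _ ((isUnit_iff_isUnit_det R).1 hR.isUnit)]
    exact hML

theorem rightInv_mul {r s : ℕ} (h : r = s) {B : Matrix (Fin r) (Fin s) ℂ} (hB : B.rank = r) :
    rightInv B * B = 1 := by
  subst h
  exact mul_eq_one_comm.1 (mul_rightInv hB)

theorem submatrix_castLE_mul_one_submatrix_castLE {m R : Type*} [NonAssocSemiring R] {r k : ℕ}
    (h : r = k) (M : Matrix m (Fin k) R) :
    M.submatrix id (Fin.castLE h.le) *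
      (1 : Matrix (Fin k) (Fin k) R).submatrix (Fin.castLE h.le) id = M := by
  subst h
  exact Matrix.mul_one M

end Normalization

section Existence

variable {k N : ℕ}

/-- The product `B (j-1) ⋯ B 0`: the leading coefficient of the `j`-th recurrence polynomial is its
inverse. -/
def blockProd (B : ∀ j, Matrix (Fin (blockSize k N (j + 1))) (Fin (blockSize k N j)) ℂ) :
    ∀ j, Matrix (Fin (blockSize k N j)) (Fin k) ℂ
  | 0 => (1 : Matrix (Fin k) (Fin k) ℂ).submatrix (Fin.castLE (blockSize_le k N 0)) id
  | j + 1 => B j * blockProd B j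

/-- The monic orthogonal polynomials of the spectral measure of a block tridiagonal matrix. -/
def monicPoly (A : ∀ j, Matrix (Fin (blockSize k N j)) (Fin (blockSize k N j)) ℂ)
    (B : ∀ j, Matrix (Fin (blockSize k N (j + 1))) (Fin (blockSize k N j)) ℂ) :
    ℕ → Matrix (Fin k) (Fin k) ℂ[X]
  | 0 => 1
  | j + 1 => residual (recPoly A B) A B j * (blockProd B j).map C

variable {A : ∀ j, Matrix (Fin (blockSize k N j)) (Fin (blockSize k N j)) ℂ}
  {B : ∀ j, Matrix (Fin (blockSize k N (j + 1))) (Fin (blockSize k N j)) ℂ}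

theorem natDegree_monicPoly_le (j : ℕ) (a b : Fin k) : (monicPoly A B j a b).natDegree ≤ j := by
  cases j with
  | zero =>
    rw [monicPoly, Matrix.one_apply]
    split_ifs <;> simp
  | succ j =>
    exact natDegree_mul_map_C_le
      (natDegree_residual_le A B fun i _ => natDegree_recPoly_le A B i) _ a b

theorem recPoly_mul_blockProd (hk : 0 < k) (hB : HasFullRank B) {j : ℕ}
    (hj : j + 1 < numBlocks k N) : recPoly A B j * (blockProd B j).map C = monicPoly A B j := by
  cases j with
  | zero =>
    rw [recPoly_zero, blockProd, ← submatrix_map, Matrix.map_one _ C.map_zero C.map_one]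
    exact submatrix_castLE_mul_one_submatrix_castLE (blockSize_eq hk hj) 1
  | succ j =>
    have hsize : blockSize k N (j + 1) = blockSize k N j :=
      (blockSize_eq hk hj).trans (blockSize_eq hk (j.succ.lt_succ_self.trans hj)).symm
    rw [recPoly_succ, Matrix.mul_assoc, ← Matrix.map_mul, blockProd, ← Matrix.mul_assoc,
      rightInv_mul hsize (hB j (j.succ.lt_succ_self.trans hj)), Matrix.one_mul, monicPoly]

theorem coeff_monicPoly (hk : 0 < k) (hB : HasFullRank B) {j : ℕ} (hj : j < numBlocks k N) :
    (monicPoly A B j).map (fun p => p.coeff j) = 1 := by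
  induction j with
  | zero =>
    ext a b
    rw [monicPoly, Matrix.map_apply, Matrix.one_apply, Matrix.one_apply]
    split_ifs <;> simp
  | succ j ih =>
    rw [monicPoly, coeff_mul_map_C, coeff_residual A B fun i _ => natDegree_recPoly_le A B i,
      ← coeff_mul_map_C, recPoly_mul_blockProd hk hB hj, ih (j.lt_succ_self.trans hj)]

theorem polyEval_monicPoly (hk : 0 < k) (hkN : k ≤ N) (hB : HasFullRank B) (j : ℕ) :
    polyEval (blockTridiag k N A B) (headCols hkN) (monicPoly A B j) =
      blockSel k N j * blockProd B j := by
  cases j with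
  | zero =>
    rw [← polyEval_one_submatrix_castLE (blockTridiag k N A B) hkN, polyEval_submatrix, monicPoly]
    exact (submatrix_castLE_mul_one_submatrix_castLE (blockSize_zero hkN) _).symm
  | succ j =>
    rw [monicPoly, polyEval_mul_map_C, polyEval_residual hk hkN
      (fun i _ => polyEval_recPoly hk hkN hB i) rfl fun _ _ => rfl, blockProd, Matrix.mul_assoc]

theorem isMonicOrthogonal_monicPoly (hk : 0 < k) (hkN : k ≤ N) {μ : MatMeasure k}
    (hμ : IsModel (blockTridiag k N A B) (headCols hkN) μ) (hB : HasFullRank B) :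
    IsMonicOrthogonal μ (numBlocks k N) (monicPoly A B) := by
  refine ⟨fun j hj => ⟨natDegree_monicPoly_le j, coeff_monicPoly hk hB hj⟩,
    fun i _ j _ hij => ?_⟩
  rw [hμ, polyEval_monicPoly hk hkN hB, polyEval_monicPoly hk hkN hB, conjTranspose_mul,
    Matrix.mul_assoc, conjTranspose_blockSel_mul_blockSel_mul_of_ne hij, Matrix.mul_zero]

theorem exists_recPoly_eq_monicPoly_mul (hk : 0 < k) (hkN : k ≤ N) {μ : MatMeasure k}
    (hμ : IsModel (blockTridiag k N A B) (headCols hkN) μ) (hB : HasFullRank B) {j : ℕ}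
    (hj : j + 1 < numBlocks k N) :
    ∃ R Q : Matrix (Fin k) (Fin k) ℂ, R.PosDef ∧
      R * R = quasiInner μ (monicPoly A B j) (monicPoly A B j) ∧ Q ∈ unitaryGroup (Fin k) ℂ ∧
      recPoly A B j =
        (monicPoly A B j * (R⁻¹ * Q).map C).submatrix id (Fin.castLE (blockSize_le k N j)) := by
  have hprod := recPoly_mul_blockProd (A := A) hk hB hj
  have hleft : (recPoly A B j).map (fun p => p.coeff j) * blockProd B j = 1 := by
    rw [← coeff_mul_map_C, hprod, coeff_monicPoly hk hB (j.lt_succ_self.trans hj)]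
  obtain ⟨R, Q, hR, hRR, hQ, hone⟩ :=
    exists_unitary_mul_inv_sqrt_gram_eq_one (blockSize_eq hk hj) hleft
  refine ⟨R, Q, hR, ?_, hQ, ?_⟩
  · rw [hRR, hμ, polyEval_monicPoly hk hkN hB, conjTranspose_mul, Matrix.mul_assoc,
      conjTranspose_blockSel_mul_blockSel_mul]
  · calc recPoly A B j
        = recPoly A B j * (blockProd B j * (R⁻¹ * Q).submatrix id (Fin.castLE _)).map C := by
          rw [hone, Matrix.map_one _ C.map_zero C.map_one, Matrix.mul_one]
      _ = recPoly A B j * (blockProd B j).map C *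
            ((R⁻¹ * Q).submatrix id (Fin.castLE _)).map C := by
          rw [Matrix.map_mul, Matrix.mul_assoc]
      _ = _ := by
          rw [hprod]
          rfl

theorem isNormalizedOPS_recPoly (hk : 0 < k) (hkN : k ≤ N) {μ : MatMeasure k}
    (hμ : IsModel (blockTridiag k N A B) (headCols hkN) μ) (hB : HasFullRank B)
    (hupper : ∀ j, j + 2 < numBlocks k N → IsUpperTriangularPos (B j))
    (hechelon : ∀ j, j + 2 = numBlocks k N → IsRowEchelonPos (B j)) :
    IsNormalizedOPS k N μ (recPoly A B) A B where
  zero := recPoly_zero A B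
  normalization := ⟨monicPoly A B, isMonicOrthogonal_monicPoly hk hkN hμ hB,
    fun _ hj => exists_recPoly_eq_monicPoly_mul hk hkN hμ hB hj⟩
  diag j _ := by
    rw [hμ, polyEval_X_smul, polyEval_recPoly hk hkN hB,
      conjTranspose_blockSel_mul_mul_blockSel, block_blockTridiag_self A B hk]
  subdiag j _ := by
    rw [hμ, polyEval_X_smul, polyEval_recPoly hk hkN hB, polyEval_recPoly hk hkN hB,
      conjTranspose_blockSel_mul_mul_blockSel, block_blockTridiag_succ A B hk]
  subdiag_pos := hupper
  last_echelon := hechelon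
  last_norm j _ := by
    rw [hμ, polyEval_residual hk hkN (fun i _ => polyEval_recPoly hk hkN hB i) rfl fun _ _ => rfl,
      conjTranspose_mul, Matrix.mul_assoc, conjTranspose_blockSel_mul_blockSel_mul]
  last_poly j _ := recPoly_succ A B j

end Existence

/-! ### Uniqueness of the recurrence matrix -/

section Uniqueness

variable {k N : ℕ} {A A' : ∀ j, Matrix (Fin (blockSize k N j)) (Fin (blockSize k N j)) ℂ}
  {B B' : ∀ j, Matrix (Fin (blockSize k N (j + 1))) (Fin (blockSize k N j)) ℂ}
  {P : ∀ j, Matrix (Fin k) (Fin (blockSize k N j)) ℂ[X]} {μ : MatMeasure k} {j : ℕ}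

theorem isRowEchelonPos_of_add_one_lt
    (hupper : ∀ j, j + 2 < numBlocks k N → IsUpperTriangularPos (B j))
    (hechelon : ∀ j, j + 2 = numBlocks k N → IsRowEchelonPos (B j)) (hj : j + 1 < numBlocks k N) :
    IsRowEchelonPos (B j) := by
  obtain hlast | hmid := (Nat.succ_le_of_lt hj).eq_or_lt
  · exact hechelon j hlast
  · exact ((hupper j hmid).hasPivots (blockSize_succ_le k N j)).isRowEchelonPos

namespace IsNormalizedOPS

theorem natDegree_le (h : IsNormalizedOPS k N μ P A B) (hj : j + 1 < numBlocks k N) (a : Fin k)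
    (b : Fin (blockSize k N j)) : (P j a b).natDegree ≤ j := by
  obtain ⟨Pi, hPi, hP⟩ := h.normalization
  obtain ⟨R, Q, -, -, -, hPj⟩ := hP j hj
  rw [hPj]
  exact natDegree_mul_map_C_le (hPi.1 j (j.lt_succ_self.trans hj)).1 _ a _

section Gram

variable {ι : Type*} [Fintype ι] [DecidableEq ι] {T : Matrix ι ι ℂ} {E : Matrix ι (Fin k) ℂ}

theorem conjTranspose_polyEval_mul_polyEval_of_ne (h : IsNormalizedOPS k N μ P A B)
    (hμ : IsModel T E μ) {i : ℕ} (hi : i + 1 < numBlocks k N) (hj : j + 1 < numBlocks k N)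
    (hij : i ≠ j) : (polyEval T E (P i))ᴴ * polyEval T E (P j) = 0 := by
  obtain ⟨Pi, hPi, hP⟩ := h.normalization
  obtain ⟨R, Q, -, -, -, hPi'⟩ := hP i hi
  obtain ⟨R', Q', -, -, -, hPj'⟩ := hP j hj
  have horth := hPi.2 i (i.lt_succ_self.trans hi) j (j.lt_succ_self.trans hj) hij
  rw [hμ] at horth
  rw [hPi', hPj', polyEval_submatrix, polyEval_submatrix, polyEval_mul_map_C, polyEval_mul_map_C,
    conjTranspose_submatrix, ← submatrix_mul _ _ _ _ _ Function.bijective_id, conjTranspose_mul,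
    Matrix.mul_assoc, ← Matrix.mul_assoc _ (polyEval T E (Pi j)), horth, Matrix.zero_mul,
    Matrix.mul_zero]
  rfl

theorem conjTranspose_polyEval_mul_polyEval_self (h : IsNormalizedOPS k N μ P A B)
    (hμ : IsModel T E μ) (hj : j + 1 < numBlocks k N) :
    (polyEval T E (P j))ᴴ * polyEval T E (P j) = 1 := by
  obtain ⟨Pi, -, hP⟩ := h.normalization
  obtain ⟨R, Q, hR, hRR, hQ, hPj⟩ := hP j hj
  have hdet : IsUnit R.det := (isUnit_iff_isUnit_det R).1 hR.isUnit
  rw [hμ] at hRR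
  rw [mem_unitaryGroup_iff', star_eq_conjTranspose] at hQ
  have hgram : (R⁻¹ * Q)ᴴ * (R * R) * (R⁻¹ * Q) = 1 := by
    rw [conjTranspose_mul, conjTranspose_nonsing_inv, hR.isHermitian.eq, Matrix.mul_assoc,
      Matrix.mul_assoc R R, mul_nonsing_inv_cancel_left _ _ hdet, Matrix.mul_assoc,
      nonsing_inv_mul_cancel_left _ _ hdet, hQ]
  rw [hPj, polyEval_submatrix, polyEval_mul_map_C, conjTranspose_submatrix,
    ← submatrix_mul _ _ _ _ _ Function.bijective_id, conjTranspose_mul, Matrix.mul_assoc,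
    ← Matrix.mul_assoc _ (polyEval T E (Pi j)), ← hRR, ← Matrix.mul_assoc, hgram]
  exact submatrix_one _ (Fin.castLE_injective _)

end Gram

/-- Orthogonality kills the blocks above the `(j + 1)`-st one, the degree bound those below. -/
theorem exists_polyEval_eq_blockSel_mul (h : IsNormalizedOPS k N μ P A B) (hk : 0 < k) (hkN : k ≤ N)
    {J : Matrix (Fin N) (Fin N) ℂ} (hμ : IsModel J (headCols hkN) μ)
    (hJ : ∀ r c : Fin N, (c : ℕ) / k + 1 < (r : ℕ) / k → J r c = 0)
    (hP : ∀ i ≤ j, polyEval J (headCols hkN) (P i) = blockSel k N i)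
    (hj : j + 2 < numBlocks k N) :
    ∃ V : Matrix (Fin (blockSize k N (j + 1))) (Fin (blockSize k N (j + 1))) ℂ,
      Vᴴ * V = 1 ∧ polyEval J (headCols hkN) (P (j + 1)) = blockSel k N (j + 1) * V := by
  have hF : blockSel k N (j + 1) * ((blockSel k N (j + 1))ᴴ *
      polyEval J (headCols hkN) (P (j + 1))) = polyEval J (headCols hkN) (P (j + 1)) := by
    refine blockSel_mul_conjTranspose_blockSel_mul hk fun i _ hij => ?_
    obtain hlt | hgt := hij.lt_or_gt
    · rw [← hP i (Nat.le_of_lt_succ hlt)]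
      exact h.conjTranspose_polyEval_mul_polyEval_of_ne hμ (by omega) hj hij
    · ext a b
      rw [conjTranspose_blockSel_mul]
      refine polyEval_headCols_apply_eq_zero hkN hJ (fun c => h.natDegree_le hj c b) ?_
      rwa [blockIndex_div]
  refine ⟨_, ?_, hF.symm⟩
  have hnorm := h.conjTranspose_polyEval_mul_polyEval_self hμ hj
  rwa [← hF, conjTranspose_mul, Matrix.mul_assoc, conjTranspose_blockSel_mul_blockSel_mul] at hnorm

theorem diag_eq (h : IsNormalizedOPS k N μ P A' B') (hk : 0 < k) (hkN : k ≤ N)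
    (hμ : IsModel (blockTridiag k N A B) (headCols hkN) μ) (hj : j < numBlocks k N)
    (hP : polyEval (blockTridiag k N A B) (headCols hkN) (P j) = blockSel k N j) :
    A' j = A j := by
  rw [h.diag j hj, hμ, polyEval_X_smul, hP, conjTranspose_blockSel_mul_mul_blockSel,
    block_blockTridiag_self A B hk]

theorem subdiag_eq_of_add_two_lt (h : IsNormalizedOPS k N μ P A' B') (hk : 0 < k) (hkN : k ≤ N)
    (hμ : IsModel (blockTridiag k N A B) (headCols hkN) μ) (hfull : HasFullRank B)
    (hechelon : ∀ j, j + 1 < numBlocks k N → IsRowEchelonPos (B j))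
    (hP : ∀ i ≤ j, polyEval (blockTridiag k N A B) (headCols hkN) (P i) = blockSel k N i)
    (hj : j + 2 < numBlocks k N) :
    B' j = B j ∧
      polyEval (blockTridiag k N A B) (headCols hkN) (P (j + 1)) = blockSel k N (j + 1) := by
  have hj' : j + 1 < numBlocks k N := (j + 1).lt_succ_self.trans hj
  obtain ⟨V, hVV, hF⟩ := h.exists_polyEval_eq_blockSel_mul hk hkN hμ
    (fun _ _ => blockTridiag_apply_eq_zero A B hk) hP hj
  have hVB : B' j = Vᴴ * B j := by
    rw [h.subdiag j hj, hμ, polyEval_X_smul, hP j le_rfl, hF, conjTranspose_mul, Matrix.mul_assoc,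
      conjTranspose_blockSel_mul_mul_blockSel, block_blockTridiag_succ A B hk]
  have hB : B' j = B j := by
    refine (isRowEchelonPos_of_add_one_lt h.subdiag_pos h.last_echelon hj').eq_of_gram_eq
      (hechelon j hj') ?_
    rw [hVB, conjTranspose_mul, conjTranspose_conjTranspose, Matrix.mul_assoc,
      ← Matrix.mul_assoc V, mul_eq_one_comm.1 hVV, Matrix.one_mul]
  have hV : Vᴴ = 1 := by
    rw [← Matrix.mul_one Vᴴ, ← mul_rightInv (hfull j hj'), ← Matrix.mul_assoc, ← hVB, hB]
  refine ⟨hB, ?_⟩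
  rw [hF, conjTranspose_eq_one.1 hV, Matrix.mul_one]

theorem subdiag_eq_of_add_two_eq (h : IsNormalizedOPS k N μ P A' B') (hk : 0 < k) (hkN : k ≤ N)
    (hμ : IsModel (blockTridiag k N A B) (headCols hkN) μ) (hfull : HasFullRank B)
    (hechelon : ∀ j, j + 1 < numBlocks k N → IsRowEchelonPos (B j))
    (hP : ∀ i ≤ j, polyEval (blockTridiag k N A B) (headCols hkN) (P i) = blockSel k N i)
    (hlt : ∀ i < j, B' i = B i) (hj : j + 2 = numBlocks k N) :
    B' j = B j ∧
      polyEval (blockTridiag k N A B) (headCols hkN) (P (j + 1)) = blockSel k N (j + 1) := by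
  have hj' : j + 1 < numBlocks k N := Nat.lt_of_succ_le hj.le
  have hres := polyEval_residual hk hkN hP
    (h.diag_eq hk hkN hμ (j.lt_succ_self.trans hj') (hP j le_rfl)) hlt
  have hB : B' j = B j := by
    refine (h.last_echelon j hj).eq_of_gram_eq (hechelon j hj') ?_
    rw [← h.last_norm j hj, hμ, hres, conjTranspose_mul, Matrix.mul_assoc,
      conjTranspose_blockSel_mul_blockSel_mul]
  refine ⟨hB, ?_⟩
  rw [h.last_poly j hj, polyEval_mul_map_C, hres, hB, Matrix.mul_assoc,
    mul_rightInv (hfull j hj'), Matrix.mul_one]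

theorem polyEval_eq_and_subdiag_eq (h : IsNormalizedOPS k N μ P A' B') (hk : 0 < k) (hkN : k ≤ N)
    (hμ : IsModel (blockTridiag k N A B) (headCols hkN) μ) (hfull : HasFullRank B)
    (hechelon : ∀ j, j + 1 < numBlocks k N → IsRowEchelonPos (B j)) (hj : j < numBlocks k N) :
    polyEval (blockTridiag k N A B) (headCols hkN) (P j) = blockSel k N j ∧
      ∀ i < j, B' i = B i := by
  induction j using Nat.strong_induction_on with
  | _ j ih =>
  cases j with
  | zero =>
    exact ⟨by rw [h.zero, polyEval_one_submatrix_castLE], fun i hi => absurd hi i.not_lt_zero⟩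
  | succ j =>
    have hP : ∀ i ≤ j, polyEval (blockTridiag k N A B) (headCols hkN) (P i) = blockSel k N i :=
      fun i hi => (ih i (Nat.lt_succ_of_le hi) (by omega)).1
    have hlt := (ih j j.lt_succ_self (j.lt_succ_self.trans hj)).2
    obtain ⟨hB, hPj⟩ : B' j = B j ∧
        polyEval (blockTridiag k N A B) (headCols hkN) (P (j + 1)) = blockSel k N (j + 1) := by
      obtain hlast | hmid := (Nat.succ_le_of_lt hj).eq_or_lt
      · exact h.subdiag_eq_of_add_two_eq hk hkN hμ hfull hechelon hP hlt hlast
      · exact h.subdiag_eq_of_add_two_lt hk hkN hμ hfull hechelon hP hmid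
    exact ⟨hPj, Nat.forall_lt_succ_right.2 ⟨hlt, hB⟩⟩

theorem blockTridiag_eq (h : IsNormalizedOPS k N μ P A' B') (hk : 0 < k) (hkN : k ≤ N)
    (hμ : IsModel (blockTridiag k N A B) (headCols hkN) μ) (hfull : HasFullRank B)
    (hechelon : ∀ j, j + 1 < numBlocks k N → IsRowEchelonPos (B j)) :
    blockTridiag k N A' B' = blockTridiag k N A B := by
  have hstep {j : ℕ} (hj : j < numBlocks k N) :=
    h.polyEval_eq_and_subdiag_eq hk hkN hμ hfull hechelon hj
  rw [blockTridiag, blockTridiag]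
  congr 1
  · refine Finset.sum_congr rfl fun j hj => ?_
    rw [h.diag_eq hk hkN hμ (Finset.mem_range.1 hj) (hstep (Finset.mem_range.1 hj)).1]
  · refine Finset.sum_congr rfl fun j hj => ?_
    rw [(hstep (Nat.add_lt_of_lt_sub (Finset.mem_range.1 hj))).2 j j.lt_succ_self]

end IsNormalizedOPS

end Uniqueness

/-! ### Gram–Schmidt orthonormalization as a reduction to echelon form -/

section GramSchmidt

open InnerProductSpace

section InnerProductSpace

variable {𝕜 E ι : Type*} [RCLike 𝕜] [NormedAddCommGroup E] [InnerProductSpace 𝕜 E] [LinearOrder ι]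
  [LocallyFiniteOrderBot ι] [WellFoundedLT ι]

theorem inner_gramSchmidtNormed_eq_zero (f : ι → E) {i j : ι} (hij : i < j) :
    inner 𝕜 (gramSchmidtNormed 𝕜 f j) (f i) = 0 := by
  rw [gramSchmidtNormed, inner_smul_left, gramSchmidt_inv_triangular 𝕜 f hij, mul_zero]

theorem inner_gramSchmidtNormed_self (f : ι → E) (i : ι) :
    inner 𝕜 (gramSchmidtNormed 𝕜 f i) (f i) = (‖gramSchmidt 𝕜 f i‖ : 𝕜) := by
  have hinner : inner 𝕜 (gramSchmidt 𝕜 f i) (f i) = (‖gramSchmidt 𝕜 f i‖ : 𝕜) ^ 2 := by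
    rw [gramSchmidt_def'' 𝕜 f i, inner_add_right, inner_sum, Finset.sum_eq_zero, add_zero]
    · exact inner_self_eq_norm_sq_to_K _
    · intro j hj
      rw [inner_smul_right, gramSchmidt_orthogonal 𝕜 f (Finset.mem_Iio.1 hj).ne', mul_zero]
  rw [gramSchmidtNormed, inner_smul_left, hinner, map_inv₀, RCLike.conj_ofReal, sq,
    ← mul_assoc, inv_mul_mul_self]

theorem card_gramSchmidtNormed_ne_zero [Finite ι] (f : ι → E) :
    Nat.card {i | gramSchmidtNormed 𝕜 f i ≠ 0} = Set.finrank 𝕜 (Set.range f) := by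
  classical
  have := Fintype.ofFinite ι
  have hrange : (Set.range fun i : {i | gramSchmidtNormed 𝕜 f i ≠ 0} => gramSchmidtNormed 𝕜 f i) =
      Set.range (gramSchmidtNormed 𝕜 f) \ {0} := by
    aesop
  rw [Nat.card_eq_fintype_card,
    ← finrank_span_eq_card (gramSchmidtNormed_orthonormal' f).linearIndependent, hrange,
    Submodule.span_sdiff_singleton_zero, span_gramSchmidtNormed_range, span_gramSchmidt,
    Set.finrank]

theorem gramSchmidtNormed_ne_zero_iff (f : ι → E) (i : ι) :
    gramSchmidtNormed 𝕜 f i ≠ 0 ↔ gramSchmidt 𝕜 f i ≠ 0 := by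
  simp [gramSchmidtNormed]

end InnerProductSpace

theorem conjTranspose_mul_apply_eq_inner {l m n : Type*} [Fintype m] (u : l → EuclideanSpace ℂ m)
    (f : n → EuclideanSpace ℂ m) (i : l) (c : n) :
    ((Matrix.of fun r i => u i r)ᴴ * Matrix.of fun r c => f c r) i c = inner ℂ (u i) (f c) := by
  simp only [Matrix.mul_apply, PiLp.inner_apply, RCLike.inner_apply, conjTranspose_apply, of_apply,
    mul_comm, starRingEnd_apply]

theorem exists_unitary_hasPivots {N m : ℕ} {K : Matrix (Fin N) (Fin m) ℂ} (hK : K.rank = N) :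
    ∃ (U : Matrix (Fin N) (Fin N) ℂ) (p : Fin N → Fin m), Uᴴ * U = 1 ∧ HasPivots (Uᴴ * K) p ∧
      ∀ c, LinearIndependent ℂ (fun i : Set.Iic c => K.col i) → c ∈ Set.range p := by
  classical
  let e := (WithLp.linearEquiv 2 ℂ (Fin N → ℂ)).symm
  let f : Fin m → EuclideanSpace ℂ (Fin N) := fun c => e (K.col c)
  let g := gramSchmidtNormed ℂ f
  have hcard : (Finset.univ.filter fun c => g c ≠ 0).card = N := by
    rw [← Fintype.card_subtype, ← Nat.card_eq_fintype_card]
    refine (card_gramSchmidtNormed_ne_zero f).trans (Eq.trans ?_ hK)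
    rw [rank_eq_finrank_span_cols, Set.finrank, show f = e ∘ K.col from rfl, Set.range_comp,
      ← LinearEquiv.coe_coe, ← Submodule.map_span, LinearEquiv.finrank_map_eq]
  let p := Finset.orderEmbOfFin _ hcard
  have hp i : g (p i) ≠ 0 := (Finset.mem_filter.1 (Finset.orderEmbOfFin_mem _ hcard i)).2
  have horth : Orthonormal ℂ (g ∘ p) :=
    (gramSchmidtNormed_orthonormal' f).comp (fun i => ⟨p i, hp i⟩)
      fun i j hij => p.injective (Subtype.mk.inj hij)
  have hUK i c : ((Matrix.of fun r i => g (p i) r)ᴴ * K) i c = inner ℂ (g (p i)) (f c) :=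
    conjTranspose_mul_apply_eq_inner (g ∘ p) f i c
  refine ⟨Matrix.of fun r i => g (p i) r, p, ?_, ⟨p.strictMono, fun i c hc => ?_, fun i => ?_⟩,
    fun c hc => ?_⟩
  · ext i j
    exact (conjTranspose_mul_apply_eq_inner (g ∘ p) (g ∘ p) i j).trans
      ((orthonormal_iff_ite.1 horth i j).trans Matrix.one_apply.symm)
  · rw [hUK, inner_gramSchmidtNormed_eq_zero f hc]
  · rw [hUK, inner_gramSchmidtNormed_self]
    exact RCLike.ofReal_pos.2 (norm_pos_iff.2 ((gramSchmidtNormed_ne_zero_iff f (p i)).1 (hp i)))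
  · have hgc : g c ≠ 0 := (gramSchmidtNormed_ne_zero_iff f c).2
      (gramSchmidt_ne_zero_coe c (hc.map' e.toLinearMap (LinearEquiv.ker _)))
    rw [Finset.range_orderEmbOfFin]
    simpa using hgc

end GramSchmidt

/-! ### Recognizing banded matrices by their pivots -/

theorem val_le_val_apply_of_strictMono {m n : ℕ} {p : Fin m → Fin n} (hp : StrictMono p)
    (i : Fin m) : (i : ℕ) ≤ p i := by
  have hcard : (Finset.Iio i).card ≤ (Finset.Iio (p i)).card :=
    Finset.card_le_card_of_injOn p (fun j hj => by simpa using hp (by simpa using hj))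
      hp.injective.injOn
  rwa [Fin.card_Iio, Fin.card_Iio] at hcard

theorem val_apply_eq_val_of_strictMono {m n d : ℕ} {p : Fin m → Fin n} (hp : StrictMono p)
    (hrange : ∀ c : Fin n, (c : ℕ) < d → c ∈ Set.range p) (i : Fin m) (hi : (i : ℕ) < d) :
    (p i : ℕ) = i := by
  induction i using WellFoundedLT.induction with
  | ind i ih =>
    obtain ⟨i', hi'⟩ := hrange ⟨i, (val_le_val_apply_of_strictMono hp i).trans_lt (p i).isLt⟩ hi
    have hpi' : (p i' : ℕ) = i := congrArg Fin.val hi'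
    have hle : i' ≤ i := (val_le_val_apply_of_strictMono hp i').trans hpi'.le
    obtain hlt | rfl := hle.lt_or_eq
    · exact absurd (Fin.ext ((ih i' hlt (lt_trans hlt hi)).symm.trans hpi')) hlt.ne
    · exact hpi'

section Pivots

variable {k N : ℕ} {J : Matrix (Fin N) (Fin N) ℂ} {p : Fin N → Fin (numBlocks k N * k)} {j : ℕ}

theorem block_eq_zero_of_pivots (hp : StrictMono p)
    (hzero : ∀ r c : Fin N, (c : ℕ) + k < p r → J r c = 0) {i : ℕ} (hij : j + 1 < i) :
    block k J i j = 0 := by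
  ext a b
  refine hzero _ _ (lt_of_lt_of_le ?_ (val_le_val_apply_of_strictMono hp _))
  have hb : (b : ℕ) < k := b.isLt.trans_le (blockSize_le k N j)
  have hmul : (j + 2) * k ≤ i * k := Nat.mul_le_mul_right k hij
  simp only [val_blockIndex]
  linarith

theorem add_val_eq_of_pivots (hpe : ∀ r : Fin N, (r : ℕ) < (numBlocks k N - 1) * k → (p r : ℕ) = r)
    (hj : j + 1 < numBlocks k N) (a : Fin (blockSize k N j)) :
    (p (blockIndex k N j a) : ℕ) = j * k + a := by
  refine hpe _ ?_
  have ha : (a : ℕ) < k := a.isLt.trans_le (blockSize_le k N j)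
  have hmul : (j + 1) * k ≤ (numBlocks k N - 1) * k := Nat.mul_le_mul_right k (by omega)
  rw [val_blockIndex]
  linarith

theorem exists_hasPivots_block (hk : 0 < k) (hp : StrictMono p)
    (hpe : ∀ r : Fin N, (r : ℕ) < (numBlocks k N - 1) * k → (p r : ℕ) = r)
    (hzero : ∀ r c : Fin N, (c : ℕ) + k < p r → J r c = 0)
    (hpos : ∀ r c : Fin N, (c : ℕ) + k = p r → 0 < J r c) (hj : j + 1 < numBlocks k N) :
    ∃ q, HasPivots (block k J (j + 1) j) q := by
  have hpivot (a : Fin (blockSize k N (j + 1))) :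
      ∃ c : Fin (blockSize k N j), (p (blockIndex k N (j + 1) a) : ℕ) = (j + 1) * k + c := by
    have hle := val_le_val_apply_of_strictMono hp (blockIndex k N (j + 1) a)
    rw [val_blockIndex] at hle
    obtain ⟨c, hc⟩ := Nat.exists_eq_add_of_le ((Nat.le_add_right _ _).trans hle)
    refine ⟨⟨c, ?_⟩, hc⟩
    rw [blockSize_eq hk hj]
    obtain hlast | hmid := (Nat.succ_le_of_lt hj).eq_or_lt
    · have hlt := (p (blockIndex k N (j + 1) a)).isLt
      rw [hc, ← hlast, Nat.succ_eq_add_one] at hlt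
      linarith
    · have hc' : c = a :=
        Nat.add_left_cancel (hc.symm.trans (add_val_eq_of_pivots hpe hmid a))
      exact hc' ▸ a.isLt.trans_le (blockSize_le k N _)
  choose q hq using hpivot
  refine ⟨q, fun a b hab => ?_, fun a c hc => hzero _ _ ?_, fun a => hpos _ _ ?_⟩
  · have hlt : (p (blockIndex k N (j + 1) a) : ℕ) < p (blockIndex k N (j + 1) b) :=
      hp (Nat.add_lt_add_left (Fin.lt_def.1 hab) _)
    rw [hq, hq] at hlt
    exact Fin.lt_def.2 (Nat.lt_of_add_lt_add_left hlt)
  · rw [hq, val_blockIndex]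
    linarith [Fin.lt_def.1 hc]
  · rw [hq, val_blockIndex]
    ring

theorem isUpperTriangularPos_block
    (hpe : ∀ r : Fin N, (r : ℕ) < (numBlocks k N - 1) * k → (p r : ℕ) = r)
    (hzero : ∀ r c : Fin N, (c : ℕ) + k < p r → J r c = 0)
    (hpos : ∀ r c : Fin N, (c : ℕ) + k = p r → 0 < J r c) (hj : j + 2 < numBlocks k N) :
    IsUpperTriangularPos (block k J (j + 1) j) := by
  refine ⟨fun a b hab => hzero _ _ ?_, fun a b hab => hpos _ _ ?_⟩
  · rw [add_val_eq_of_pivots hpe hj, val_blockIndex]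
    linarith
  · rw [add_val_eq_of_pivots hpe hj, val_blockIndex]
    linarith

theorem mem_bandedClass_of_pivots (hk : 0 < k) (hJ : J.IsHermitian) (hp : StrictMono p)
    (hpe : ∀ r : Fin N, (r : ℕ) < (numBlocks k N - 1) * k → (p r : ℕ) = r)
    (hzero : ∀ r c : Fin N, (c : ℕ) + k < p r → J r c = 0)
    (hpos : ∀ r c : Fin N, (c : ℕ) + k = p r → 0 < J r c) : J ∈ bandedClass k N := by
  have hpivots {j : ℕ} (hj : j + 1 < numBlocks k N) : ∃ q, HasPivots (block k J (j + 1) j) q :=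
    exists_hasPivots_block hk hp hpe hzero hpos hj
  refine ⟨fun j => block k J j j, fun j => block k J (j + 1) j, fun j _ => hJ.submatrix _,
    fun j hj => ?_, fun j hj => isUpperTriangularPos_block hpe hzero hpos hj, fun j hj => ?_,
    eq_blockTridiag_of_isHermitian hk hJ fun i j hij => block_eq_zero_of_pivots hp hzero hij⟩
  · obtain ⟨q, hq⟩ := hpivots hj
    rw [hq.rank_eq, Fintype.card_fin]
  · obtain ⟨q, hq⟩ := hpivots (Nat.lt_of_succ_le hj.le)
    exact hq.isRowEchelonPos

end Pivots

/-! ### Block Lanczos reduction -/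

section Krylov

variable {ι R : Type*} [Fintype ι] [DecidableEq ι] [CommRing R] {k d : ℕ}

theorem mul_krylov_apply (hk : 0 < k) (T : Matrix ι ι R) (E : Matrix ι (Fin k) R) (r : ι)
    {c c' : Fin (d * k)} (h : (c' : ℕ) = c + k) : (T * krylov T E d) r c = krylov T E d r c' := by
  have hdiv : (c' : ℕ) / k = c / k + 1 := by rw [h, Nat.add_div_right _ hk]
  have hmod : c.modNat = c'.modNat := Fin.ext (by simp [Fin.modNat, h])
  change (T * (T ^ ((c : ℕ) / k) * E)) r c.modNat = (T ^ ((c' : ℕ) / k) * E) r c'.modNat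
  rw [← Matrix.mul_assoc, ← pow_succ', hdiv, hmod]

theorem krylov_submatrix_castLE (T : Matrix ι ι R) (E : Matrix ι (Fin k) R) (h : k ≤ d * k) :
    (krylov T E d).submatrix id (Fin.castLE h) = E := by
  ext i a
  change (T ^ ((a : ℕ) / k) * E) i ⟨(a : ℕ) % k, _⟩ = E i a
  simp only [Nat.div_eq_of_lt a.isLt, Nat.mod_eq_of_lt a.isLt, pow_zero, Matrix.one_mul]

theorem linearIndependent_col_krylov_Iic {K : Type*} [Field K] {T : Matrix ι ι K}
    {E : Matrix ι (Fin k) K} (hrank : (krylov T E d).rank = d * k) {d' : ℕ} {c : Fin (d' * k)}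
    (hc : (c : ℕ) < d * k) :
    LinearIndependent K fun i : Set.Iic c => (krylov T E d').col i := by
  have hli : LinearIndependent K (krylov T E d).col :=
    Matrix.mulVec_injective_iff.1 (mulVec_injective_iff_rank_eq.2 (by rwa [Fintype.card_fin]))
  exact hli.comp (fun i : Set.Iic c => ⟨i, lt_of_le_of_lt i.2 hc⟩)
    fun i j hij => Subtype.ext (Fin.ext (Fin.mk.inj_iff.1 hij))

end Krylov

section Pivots

variable {k N d : ℕ} {J : Matrix (Fin N) (Fin N) ℂ} {E : Matrix (Fin N) (Fin k) ℂ}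
  {p : Fin N → Fin (d * k)}

namespace HasPivots

theorem mul_krylov_apply_eq (h : HasPivots (krylov J E d) p) (hk : 0 < k) {r c : Fin N}
    (hc : (p c : ℕ) = c) (hzero : ∀ i < c, J r i = 0) {c' : Fin (d * k)}
    (hc' : (c' : ℕ) = c + k) : J r c * krylov J E d c (p c) = krylov J E d r c' := by
  rw [← mul_krylov_apply hk J E r (c := p c) (hc'.trans (by rw [hc])), Matrix.mul_apply,
    Finset.sum_eq_single_of_mem c (Finset.mem_univ c)]
  intro i _ hi
  obtain hlt | hgt := hi.lt_or_gt
  · rw [hzero i hlt, zero_mul]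
  · rw [h.zero i (p c) (h.strictMono hgt), mul_zero]

theorem apply_eq_zero_of_krylov (h : HasPivots (krylov J E d) p) (hk : 0 < k)
    (hpe : ∀ r : Fin N, (r : ℕ) < (d - 1) * k → (p r : ℕ) = r) (r c : Fin N)
    (hc : (c : ℕ) + k < p r) : J r c = 0 := by
  induction c using WellFoundedLT.induction with
  | ind c ih =>
    have hlt : (c : ℕ) + k < d * k := hc.trans (p r).isLt
    have hpc : (p c : ℕ) = c := hpe c (by rw [Nat.sub_one_mul]; exact Nat.lt_sub_of_add_lt hlt)
    have hmul := h.mul_krylov_apply_eq hk hpc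
      (fun i hi => ih i hi ((Nat.add_lt_add_right hi k).trans hc)) (c' := ⟨c + k, hlt⟩) rfl
    rw [h.zero r _ hc] at hmul
    exact (mul_eq_zero.1 hmul).resolve_right (h.pos c).ne'

theorem apply_pos_of_krylov (h : HasPivots (krylov J E d) p) (hk : 0 < k)
    (hpe : ∀ r : Fin N, (r : ℕ) < (d - 1) * k → (p r : ℕ) = r) (r c : Fin N)
    (hc : (c : ℕ) + k = p r) : 0 < J r c := by
  have hlt : (c : ℕ) + k < d * k := hc ▸ (p r).isLt
  have hpc : (p c : ℕ) = c := hpe c (by rw [Nat.sub_one_mul]; exact Nat.lt_sub_of_add_lt hlt)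
  have hmul := h.mul_krylov_apply_eq hk hpc
    (fun i hi => h.apply_eq_zero_of_krylov hk hpe r i (hc ▸ Nat.add_lt_add_right hi k)) hc.symm
  rw [eq_div_of_mul_eq (h.pos c).ne' hmul]
  exact div_pos (h.pos r) (h.pos c)

end HasPivots

theorem mem_bandedClass_of_hasPivots_krylov (hk : 0 < k) (hJ : J.IsHermitian)
    {p : Fin N → Fin (numBlocks k N * k)} (h : HasPivots (krylov J E (numBlocks k N)) p)
    (hrange : ∀ c : Fin (numBlocks k N * k), (c : ℕ) < (numBlocks k N - 1) * k → c ∈ Set.range p) :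
    J ∈ bandedClass k N := by
  have hpe := val_apply_eq_val_of_strictMono h.strictMono hrange
  exact mem_bandedClass_of_pivots hk hJ h.strictMono hpe (h.apply_eq_zero_of_krylov hk hpe)
    (h.apply_pos_of_krylov hk hpe)

end Pivots

section HeadCols

variable {k N : ℕ}

theorem IsRowEchelonPos.submatrix_castLE {r s t : ℕ} {M : Matrix (Fin r) (Fin s) ℂ}
    (hM : IsRowEchelonPos M) (h : t ≤ s) : IsRowEchelonPos (M.submatrix id (Fin.castLE h)) := by
  have hlift (i : Fin r) (c : Fin t) (hc : ∀ j < c, M.submatrix id (Fin.castLE h) i j = 0) :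
      ∀ j < Fin.castLE h c, M i j = 0 := fun j hj =>
    hc ⟨j, (Fin.lt_def.1 hj).trans c.isLt⟩ hj
  exact ⟨fun i₁ i₂ hi c hc => hM.1 hi (hlift i₁ c hc),
    fun i c hc => hM.2 i _ ⟨hlift i c hc.1, hc.2⟩⟩

theorem isRowEchelonPos_headCols (hkN : k ≤ N) : IsRowEchelonPos (headCols hkN) :=
  have hone : HasPivots (1 : Matrix (Fin N) (Fin N) ℂ) id :=
    ⟨strictMono_id, fun _ _ hc => Matrix.one_apply_ne hc.ne', fun i =>
      one_pos.trans_eq (Matrix.one_apply_eq i).symm⟩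
  hone.isRowEchelonPos.submatrix_castLE hkN

theorem eq_headCols (hkN : k ≤ N) {E : Matrix (Fin N) (Fin k) ℂ} (hE : IsRowEchelonPos E)
    (horth : Eᴴ * E = 1) : E = headCols hkN := by
  refine hE.eq_of_gram_eq (isRowEchelonPos_headCols hkN) (horth.trans ?_)
  rw [mul_headCols, headCols, conjTranspose_submatrix, conjTranspose_one, submatrix_submatrix]
  exact (submatrix_one _ (Fin.castLE_injective hkN)).symm

end HeadCols

section Lanczos

variable {k N : ℕ} {μ : MatMeasure k}

namespace IsModel

section Rank

variable {ι : Type*} [Fintype ι] [DecidableEq ι] {T : Matrix ι ι ℂ} {E : Matrix ι (Fin k) ℂ}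

theorem conjTranspose_mul_self_eq_one (h : IsModel T E μ) (hμ : μ ∈ measureClass k N) :
    Eᴴ * E = 1 := by
  obtain ⟨⟨s, W, rfl, -, hsum, -⟩, -, -⟩ := hμ
  have hone := h (1 : Matrix (Fin k) (Fin k) ℂ[X]) ((1 : ℂ[X]) • (1 : Matrix (Fin k) (Fin k) ℂ[X]))
  rw [quasiInner_sum_dirac_one_smul_one, one_smul, polyEval_one] at hone
  simpa only [eval_one, one_smul, hsum] using hone.symm

theorem rank_krylov_numBlocks (h : IsModel T E μ) (hμ : μ ∈ measureClass k N) (hk : 0 < k)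
    (hkN : k ≤ N) : (krylov T E (numBlocks k N)).rank = N := by
  have hn : numBlocks k N - 1 + 1 = numBlocks k N :=
    Nat.sub_add_cancel ((lt_numBlocks_iff hk).2 (by omega))
  have hdim := h.finrank_nullPolys (numBlocks k N - 1)
  rw [hμ.2.2 _ hn, hn, defect] at hdim
  have hle := le_numBlocks_mul (N := N) hk
  omega

theorem rank_krylov_of_lt (h : IsModel T E μ) (hμ : μ ∈ measureClass k N) {d : ℕ}
    (hd : d < numBlocks k N) : (krylov T E d).rank = d * k := by
  cases d with
  | zero =>
    exact le_antisymm ((rank_le_card_width _).trans_eq (Fintype.card_fin _))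
      ((Nat.zero_mul k).trans_le (Nat.zero_le _))
  | succ d =>
    have hdim := h.finrank_nullPolys d
    rwa [hμ.2.1 d hd, zero_add] at hdim

end Rank

theorem exists_mem_bandedClass {T : Matrix (Fin N) (Fin N) ℂ} {E : Matrix (Fin N) (Fin k) ℂ}
    (h : IsModel T E μ) (hμ : μ ∈ measureClass k N) (hk : 0 < k) (hkN : k ≤ N)
    (hT : T.IsHermitian) : ∃ J ∈ bandedClass k N, IsModel J (headCols hkN) μ := by
  have hn : 0 < numBlocks k N := (lt_numBlocks_iff hk).2 (by omega)
  obtain ⟨U, p, hUU, hpivots, hrange⟩ :=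
    exists_unitary_hasPivots (h.rank_krylov_numBlocks hμ hk hkN)
  have hUU' : U * Uᴴ = 1 := mul_eq_one_comm.1 hUU
  have hTU : Uᴴ * T * U * Uᴴ = Uᴴ * T := by rw [Matrix.mul_assoc, hUU', Matrix.mul_one]
  have hmodel : IsModel (Uᴴ * T * U) (Uᴴ * E) μ :=
    h.mul_of_mul_eq_mul hTU (by rwa [conjTranspose_conjTranspose])
  rw [mul_krylov_of_mul_eq_mul hTU] at hpivots
  refine ⟨Uᴴ * T * U, mem_bandedClass_of_hasPivots_krylov hk
    (isHermitian_conjTranspose_mul_mul U hT) hpivots fun c hc => hrange c ?_, ?_⟩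
  · exact linearIndependent_col_krylov_Iic
      (h.rank_krylov_of_lt hμ (Nat.sub_one_lt_of_lt hn)) hc
  · have hechelon := hpivots.isRowEchelonPos.submatrix_castLE (Nat.le_mul_of_pos_left k hn)
    rw [krylov_submatrix_castLE] at hechelon
    rwa [← eq_headCols hkN hechelon (hmodel.conjTranspose_mul_self_eq_one hμ)]

end IsModel

end Lanczos

/-! ### The spectral map and its inverse -/

section Inverse

variable {k N : ℕ} {J J' : Matrix (Fin N) (Fin N) ℂ}

theorem isHermitian_of_mem_bandedClass (hJ : J ∈ bandedClass k N) : J.IsHermitian := by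
  obtain ⟨A, B, hA, -, -, -, rfl⟩ := hJ
  exact isHermitian_blockTridiag hA

theorem mapsTo_spectralMap (hk : 0 < k) (hkN : k ≤ N) :
    Set.MapsTo (spectralMap hkN) (bandedClass k N) (measureClass k N) := by
  rintro _ ⟨A, B, hA, hB, -, -, rfl⟩
  exact spectralMap_mem_measureClass hk hkN hA hB

theorem surjOn_spectralMap (hk : 0 < k) (hkN : k ≤ N) :
    Set.SurjOn (spectralMap hkN) (bandedClass k N) (measureClass k N) := by
  intro μ hμ
  obtain ⟨s, W, hμW, hW, -, hrank⟩ := hμ.1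
  obtain ⟨lam, v, hlam⟩ := exists_eq_rankOneSum s W hW hrank
  obtain rfl : μ = rankOneSum lam v := hμW.trans hlam
  have hdiag : (diagonal fun l => (lam l : ℂ)).IsHermitian :=
    isHermitian_diagonal_iff.2 fun l => Complex.conj_ofReal (lam l)
  obtain ⟨J, hJ, hmodel⟩ := (isModel_rankOneSum lam v).exists_mem_bandedClass hμ hk hkN hdiag
  have hherm := isHermitian_of_mem_bandedClass hJ
  have hmodel' := isModel_spectralMap hkN hherm
  rw [spectralMap_eq hkN hherm] at hmodel'
  exact ⟨J, hJ, (spectralMap_eq hkN hherm).trans (rankOneSum_eq_of_isModel hmodel' hmodel)⟩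

theorem isRecurrenceMatrix_spectralMap (hk : 0 < k) (hkN : k ≤ N) (hJ : J ∈ bandedClass k N) :
    IsRecurrenceMatrix k N (spectralMap hkN J) J := by
  obtain ⟨A, B, hA, hB, hupper, hechelon, rfl⟩ := hJ
  have hmodel := isModel_spectralMap hkN (isHermitian_blockTridiag (B := B) hA)
  exact ⟨_, A, B, isNormalizedOPS_recPoly hk hkN hmodel hB hupper hechelon, rfl⟩

theorem IsRecurrenceMatrix.eq_of_spectralMap {hkN : k ≤ N}
    (h : IsRecurrenceMatrix k N (spectralMap hkN J) J')
    (hk : 0 < k) (hJ : J ∈ bandedClass k N) : J' = J := by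
  obtain ⟨A, B, hA, hB, hupper, hechelon, rfl⟩ := hJ
  obtain ⟨P, A', B', hP, rfl⟩ := h
  exact hP.blockTridiag_eq hk hkN (isModel_spectralMap hkN (isHermitian_blockTridiag hA)) hB
    fun _ => isRowEchelonPos_of_add_one_lt hupper hechelon

theorem leftInvOn_inverseSpectralMap (hk : 0 < k) (hkN : k ≤ N) :
    Set.LeftInvOn (inverseSpectralMap k N) (spectralMap hkN) (bandedClass k N) := fun J hJ =>
  have hrec := isRecurrenceMatrix_spectralMap hk hkN hJ
  IsRecurrenceMatrix.eq_of_spectralMap (Classical.epsilon_spec ⟨J, hrec⟩) hk hJ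

end Inverse

end BandedSpectral

end

/-- The first conjunct says that the recurrence matrix of every `μ ∈ ℳ_{k,N}` exists and is unique,
so that `ψ` is well defined; the others say that `ψ` maps `ℳ_{k,N}` to `𝒥_{k,N}`, that
`φ (ψ μ) = μ`, and that `φ` is a bijection from `𝒥_{k,N}` onto `ℳ_{k,N}` with inverse `ψ`. -/
theorem mainTheorem2 (k N : ℕ) (hk : 0 < k) (hkN : k ≤ N) :
    (∀ μ ∈ BandedSpectral.measureClass k N,
      ∃! J : Matrix (Fin N) (Fin N) ℂ, BandedSpectral.IsRecurrenceMatrix k N μ J) ∧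
    (∀ μ ∈ BandedSpectral.measureClass k N,
      BandedSpectral.inverseSpectralMap k N μ ∈ BandedSpectral.bandedClass k N ∧
      BandedSpectral.spectralMap hkN (BandedSpectral.inverseSpectralMap k N μ) = μ) ∧
    Set.BijOn (BandedSpectral.spectralMap hkN)
      (BandedSpectral.bandedClass k N) (BandedSpectral.measureClass k N) ∧
    Set.InvOn (BandedSpectral.inverseSpectralMap k N) (BandedSpectral.spectralMap hkN)
      (BandedSpectral.bandedClass k N) (BandedSpectral.measureClass k N) := by
  have hleft := BandedSpectral.leftInvOn_inverseSpectralMap hk hkN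
  have hsurj := BandedSpectral.surjOn_spectralMap hk hkN
  refine ⟨fun μ hμ => ?_, fun μ hμ => ?_,
    ⟨BandedSpectral.mapsTo_spectralMap hk hkN, hleft.injOn, hsurj⟩, hleft, fun μ hμ => ?_⟩ <;>
    obtain ⟨J, hJ, rfl⟩ := hsurj hμ
  · exact ⟨J, BandedSpectral.isRecurrenceMatrix_spectralMap hk hkN hJ,
      fun J' h => h.eq_of_spectralMap hk hJ⟩
  · rw [hleft hJ]
    exact ⟨hJ, rfl⟩
  · rw [hleft hJ]
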